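/- **Definitions.** Rings are unital. For a ring $A$, a class $\mathcal C$ of right $A$-modules is called *exact* if, for every short exact sequence of right $A$-modules, whenever two of the three modules are in $\mathcal C$, so is the third; it is called *cocomplete* if it is stable under filtered colimits. The ring $A$ is *right-regular* if the class of all right $A$-modules is the only cocomplete exact class of right $A$-modules that contains all finitely generated projective ones; *left-regular* is defined in the same way with left modules. A group $G$ is *regular* if the group ring $\mathbf Z[G]$ is right-regular and left-regular (the two conditions are equivalent, since $\mathbf Z[G]$ is isomorphic to its opposite ring). Let $\overline{\rm Cl}$ be the smallest class of groups (closed under isomorphism) such that: - $\overline{\rm Cl}$ contains the trivial group; - if $H,G_1,G_2\in\overline{\rm Cl}$ and $\alpha:H\to G_1$, $\beta:H\to G_2$ are injective morphisms, then the amalgamated free product $G_1*_HG_2$ (the pushout of $\alpha$ and $\beta$) is in $\overline{\rm Cl}$; - if $H,G\in\overline{\rm Cl}$ and $\alpha,\beta:H\to G$ are injective morphisms, then the HNN extension $\langle G,t\mid t\,\alpha(h)\,t^{-1}=\beta(h),\ h\in H\rangle$ is in $\overline{\rm Cl}$; - if a group $G$ is the union of a filtered family of subgroups which are in $\overline{\rm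 Cl}$, then $G\in\overline{\rm Cl}$. A ring is *right regular noetherian* if it is right noetherian and every finitely generated right module over it has a projective resolution of finite length; it is *right regular coherent* if all its finitely generated right ideals are finitely presented and every finitely presented right module over it has a projective resolution of finite length. A group $H$ is *regular coherent* if $R[H]$ is right regular coherent for every right regular noetherian ring $R$. Waldhausen's class ${\rm Cl}$ is the smallest class of groups satisfying the four conditions above with, in the second and the third one, the additional requirement that $H$ be regular coherent. **Lemma 3.9.** 1. If $G\in\overline{\rm Cl}$ and $K$ is a subgroup of $G$, then $K\in\overline{\rm Cl}$. 2. If $1\to N\to\Gamma\to Q\to1$ is an exact sequence of groups with $N,Q\in\overline{\rm Cl}$, then $\Gamma\in\overline{\rm Cl}$. 3. Every group in $\overline{\rm Cl}$ is regular. 4. Waldhausen's class ${\rm Cl}$ is contained in $\overline{\rm Cl}$. -/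

import Mathlib

universe u

open CategoryTheory

namespace VogelRegular

section Rings

/-- A class `C` of objects of the category of left `A`-modules is exact if, for every short exact
sequence `0 → X₁ → X₂ → X₃ → 0`, as soon as two of the three modules are in `C`, so is the
third one. -/
structure IsExactClass (A : Type u) [Ring A] (C : ObjectProperty (ModuleCat.{u} A)) : Prop where
  left : ∀ S : ShortComplex (ModuleCat.{u} A), S.ShortExact → C S.X₂ → C S.X₃ → C S.X₁
  middle : ∀ S : ShortComplex (ModuleCat.{u} A), S.ShortExact → C S.X₁ → C S.X₃ → C S.X₂
  right : ∀ S : ShortComplex (ModuleCat.{u} A), S.ShortExact → C S.X₁ → C S.X₂ → C S.X₃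

/-- A class of `A`-modules is cocomplete if it is stable under (small) filtered colimits. -/
def IsCocompleteClass (A : Type u) [Ring A] (C : ObjectProperty (ModuleCat.{u} A)) : Prop :=
  ∀ (J : Type u) [SmallCategory J] [IsFiltered J], C.IsClosedUnderColimitsOfShape J

/-- `A` is regular on the left: the class of all left `A`-modules is the only cocomplete exact
class of left `A`-modules containing the finitely generated projective ones. -/
def LeftRegular (A : Type u) [Ring A] : Prop :=
  ∀ C : ObjectProperty (ModuleCat.{u} A), IsExactClass A C → IsCocompleteClass A C →
    (∀ P : ModuleCat.{u} A, Module.Finite A P → Module.Projective A P → C P) →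
    ∀ M : ModuleCat.{u} A, C M

/-- `A` is regular on the right: same condition for right `A`-modules, that is, modules over the
opposite ring. -/
def RightRegular (A : Type u) [Ring A] : Prop :=
  LeftRegular Aᵐᵒᵖ

/-- A group is regular if its integral group ring is regular on the right and on the left (the two
conditions are equivalent, since the group ring is isomorphic to its opposite). -/
def RegularGroup (G : Type u) [Group G] : Prop :=
  RightRegular (MonoidAlgebra ℤ G) ∧ LeftRegular (MonoidAlgebra ℤ G)

/-- `A` is regular noetherian on the right: it is noetherian on the right and every finitely
generated right `A`-module has a projective resolution of finite length. -/
def RightRegularNoetherian (A : Type u) [Ring A] : Prop :=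
  IsNoetherianRing Aᵐᵒᵖ ∧
    ∀ M : ModuleCat.{u} Aᵐᵒᵖ, Module.Finite Aᵐᵒᵖ M → ∃ n : ℕ, HasProjectiveDimensionLE M n

/-- `A` is regular coherent on the right: every finitely generated right ideal is finitely
presented, and every finitely presented right `A`-module has a projective resolution of finite
length. -/
def RightRegularCoherent (A : Type u) [Ring A] : Prop :=
  (∀ I : Ideal Aᵐᵒᵖ, I.FG → Module.FinitePresentation Aᵐᵒᵖ I) ∧
    ∀ M : ModuleCat.{u} Aᵐᵒᵖ, Module.FinitePresentation Aᵐᵒᵖ M →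
      ∃ n : ℕ, HasProjectiveDimensionLE M n

/-- Waldhausen's notion: a group `G` is regular coherent if, for every regular noetherian ring `R`,
the group ring `R[G]` is regular coherent. -/
def RegularCoherentGroup (G : Type u) [Group G] : Prop :=
  ∀ (R : Type u) [Ring R], RightRegularNoetherian R → RightRegularCoherent (MonoidAlgebra R G)

end Rings

section Classes

/-- The HNN extension `⟨G, t | t α(h) t⁻¹ = β(h), h ∈ H⟩` of `G` associated with two injective
morphisms `α, β : H → G`. -/
abbrev HNN {H G : Type u} [Group H] [Group G] (α β : H →* G)
    (hα : Function.Injective α) (hβ : Function.Injective β) : Type u :=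
  HNNExtension G α.range β.range
    ((MonoidHom.ofInjective hα).symm.trans (MonoidHom.ofInjective hβ))

/-- The smallest class of groups containing the trivial group, stable under filtered unions of
subgroups, and stable under those amalgamated free products and HNN extensions (along injective
morphisms) for which the amalgamated group `H` satisfies the condition `P`. -/
inductive GroupClass (P : ∀ (H : Type u) [Group H], Prop) : ∀ (G : Type u) [Group G], Prop
  | trivial (G : Type u) [Group G] (hG : Subsingleton G) : GroupClass P G
  | amalgam {H G₁ G₂ Γ : Type u} [Group H] [Group G₁] [Group G₂] [Group Γ]
      (α : H →* G₁) (β : H →* G₂) (i₁ : G₁ →* Γ) (i₂ : G₂ →* Γ)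
      (hα : Function.Injective α) (hβ : Function.Injective β)
      (hΓ : IsPushout (GrpCat.ofHom α) (GrpCat.ofHom β) (GrpCat.ofHom i₁) (GrpCat.ofHom i₂))
      (hP : P H) (hH : GroupClass P H) (h₁ : GroupClass P G₁) (h₂ : GroupClass P G₂) :
      GroupClass P Γ
  | hnn {H G Γ : Type u} [Group H] [Group G] [Group Γ] (α β : H →* G)
      (hα : Function.Injective α) (hβ : Function.Injective β) (e : HNN α β hα hβ ≃* Γ)
      (hP : P H) (hH : GroupClass P H) (hG : GroupClass P G) : GroupClass P Γ
  | union {G : Type u} [Group G] {ι : Type u} [Nonempty ι] (K : ι → Subgroup G)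
      (hdir : Directed (· ≤ ·) K) (htop : ∀ g : G, ∃ i, g ∈ K i)
      (hK : ∀ i, GroupClass P (K i)) : GroupClass P G

/-- The class `Cl` with a bar: no condition on the amalgamated groups. -/
def ClBar (G : Type u) [Group G] : Prop :=
  GroupClass.{u} (fun _ _ => True) G

/-- Waldhausen's class `Cl`: the amalgamated groups are required to be regular coherent. -/
def WaldhausenCl (G : Type u) [Group G] : Prop :=
  GroupClass.{u} (fun H _ => RegularCoherentGroup H) G

end Classes

end VogelRegular

/-! The engine is Bass–Serre theory, in a form that avoids reduced words. A graph is called a tree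
when it is connected and every edge cochain with values in an arbitrary group, possibly
non-commutative, is a coboundary. This suits both directions of the theory. Amalgams and HNN
extensions act on their coset graphs, and a potential for a cochain is read off from a morphism into
a wreath product (`isTree_of_isPushout`, `isTree_HNN`). Conversely, a group acting on a tree with
vertex and edge stabilizers in the class is itself in the class (`IsTree.clBar`): Zorn's lemma gives
a maximal connected block of vertices whose stabilizer is in the class, and an edge leaving it would
enlarge it by one amalgam or one HNN extension.

Subgroups and extensions are both cases of `ClBar.of_hom`: if `G` and the kernel of `φ : K →* G` are
in the class, so is `K`. The proof is by induction on `G`: `K` acts through `φ` on the tree of `G`,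
and its stabilizers are preimages of conjugates of smaller groups.

For regularity, a tree gives, for every module `M`, a short exact sequence `0 → M[E] → M[V] → M → 0`
with diagonal actions. Each orbit contributes a module induced from a stabilizer. Induction is
exact, commutes with colimits and preserves finitely generated projectives, so induced modules lie
in any class under test (`ind_mem`), hence so does `M` (`IsTree.mem`). For directed unions `M` is a
filtered colimit of such modules, and the trivial group reduces to the principal ideal domain `ℤ`.
Inversion in the group exchanges left and right. Waldhausen's class is contained in the larger one
by monotonicity in the condition on amalgamated groups. -/

namespace VogelRegular

/-! ### Recognizing amalgams and HNN extensions through cochains -/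

section Criteria

/-- A function which is equivariant, up to right multiplication, under a generating set of a group
is a translate of a morphism. -/
theorem exists_hom_of_right_equivariant {Γ X : Type*} [Group Γ] [Group X] (Φ : Γ → X) (S : Set Γ)
    (hS : Subgroup.closure S = ⊤) (h : ∀ x ∈ S, ∃ y, ∀ g, Φ (g * x) = Φ g * y) :
    ∃ ψ : Γ →* X, ∀ g x, Φ (g * x) = Φ g * ψ x := by
  have key : ∀ x, ∃ y, ∀ g, Φ (g * x) = Φ g * y := by
    intro x
    have hx : x ∈ Subgroup.closure S := hS ▸ Subgroup.mem_top x
    induction hx using Subgroup.closure_induction with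
    | mem x hx => exact h x hx
    | one => exact ⟨1, by simp⟩
    | mul x y _ _ hx hy =>
      obtain ⟨a, ha⟩ := hx
      obtain ⟨b, hb⟩ := hy
      exact ⟨a * b, fun g => by rw [← mul_assoc, hb, ha, mul_assoc]⟩
    | inv x _ hx =>
      obtain ⟨a, ha⟩ := hx
      refine ⟨a⁻¹, fun g => ?_⟩
      have := ha (g * x⁻¹)
      rw [inv_mul_cancel_right] at this
      rw [this, mul_inv_cancel_right]
  choose ψ hψ using key
  refine ⟨MonoidHom.mk' ψ fun x y => ?_, fun g x => hψ x g⟩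
  have h1 := hψ (x * y) 1
  rw [← mul_assoc, hψ y, hψ x, mul_assoc] at h1
  exact (mul_left_cancel h1).symm

/-- Choosing a representative in each coset of `i.range` writes every `g` as representative times `i
(r g)`; then `ψ ∘ r` works. -/
theorem exists_right_equivariant {Γ G X : Type*} [Group Γ] [Group G] [Group X] (i : G →* Γ)
    (hi : Function.Injective i) (ψ : G →* X) :
    ∃ p : Γ → X, ∀ g l, p (g * i l) = p g * ψ l := by
  have h : ∀ g : Γ, ∃ l, g = (QuotientGroup.mk g : Γ ⧸ i.range).out * i l := by
    intro g
    have : (QuotientGroup.mk g : Γ ⧸ i.range).out⁻¹ * g ∈ i.range := by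
      rw [← QuotientGroup.eq, QuotientGroup.out_eq']
    obtain ⟨l, hl⟩ := this
    exact ⟨l, by rw [hl, mul_inv_cancel_left]⟩
  choose r hr using h
  refine ⟨fun g => ψ (r g), fun g l => ?_⟩
  have h1 : (QuotientGroup.mk (g * i l) : Γ ⧸ i.range) = QuotientGroup.mk g :=
    (QuotientGroup.eq.2 (by simp)).symm
  have h2 := hr (g * i l)
  rw [h1] at h2
  nth_rewrite 1 [hr g] at h2
  rw [mul_assoc] at h2
  have h3 := mul_left_cancel h2
  rw [← map_mul] at h3
  show ψ _ = _
  rw [← hi h3, map_mul]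

/-- A group generated by two subgroups is their amalgamated product as soon as the cochains of the
associated coset graph are coboundaries. -/
theorem isPushout_of_cochains {H G₁ G₂ Γ : Type u} [Group H] [Group G₁] [Group G₂] [Group Γ]
    (α : H →* G₁) (β : H →* G₂) (i₁ : G₁ →* Γ) (i₂ : G₂ →* Γ)
    (h₁ : Function.Injective i₁) (h₂ : Function.Injective i₂) (hc : i₁.comp α = i₂.comp β)
    (hgen : i₁.range ⊔ i₂.range = ⊤)
    (h : ∀ (X : Type u) [Group X] (c : Γ → X), (∀ g n, c (g * i₁ (α n)) = c g) →
      ∃ f₁ f₂ : Γ → X, (∀ g l, f₁ (g * i₁ l) = f₁ g) ∧ (∀ g l, f₂ (g * i₂ l) = f₂ g) ∧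
        ∀ g, f₂ g = f₁ g * c g) :
    IsPushout (GrpCat.ofHom α) (GrpCat.ofHom β) (GrpCat.ofHom i₁) (GrpCat.ofHom i₂) := by
  have hS : Subgroup.closure ((i₁.range : Set Γ) ∪ i₂.range) = ⊤ := by
    rw [Subgroup.closure_union, Subgroup.closure_eq, Subgroup.closure_eq, hgen]
  have ext : ∀ {X : Type u} [Group X] (a b : Γ →* X), a.comp i₁ = b.comp i₁ →
      a.comp i₂ = b.comp i₂ → a = b := by
    intro X _ a b h1 h2
    refine MonoidHom.eq_of_eqOn_dense hS ?_
    rintro _ (⟨x, rfl⟩ | ⟨x, rfl⟩)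
    · exact DFunLike.congr_fun h1 x
    · exact DFunLike.congr_fun h2 x
  have lift : ∀ (X : Type u) [Group X] (ψ₁ : G₁ →* X) (ψ₂ : G₂ →* X), ψ₁.comp α = ψ₂.comp β →
      ∃ ψ : Γ →* X, ψ.comp i₁ = ψ₁ ∧ ψ.comp i₂ = ψ₂ := by
    intro X _ ψ₁ ψ₂ hψ
    obtain ⟨p, hp⟩ := exists_right_equivariant i₁ h₁ ψ₁
    obtain ⟨q, hq⟩ := exists_right_equivariant i₂ h₂ ψ₂
    -- The quotient of the two equivariant functions is invariant under `H`. Trivializing it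
    -- produces one function `f₁ * p = f₂ * q` equivariant under both factors, hence a translate of
    -- the desired morphism.
    obtain ⟨f₁, f₂, hf₁, hf₂, hf⟩ := h X (fun g => p g * (q g)⁻¹) (fun g n => by
      have e1 : i₁ (α n) = i₂ (β n) := DFunLike.congr_fun hc n
      have e2 : ψ₁ (α n) = ψ₂ (β n) := DFunLike.congr_fun hψ n
      rw [hp, e1, hq, e2]
      group)
    have hΦ : ∀ g, f₁ g * p g = f₂ g * q g := fun g => by rw [hf]; group
    obtain ⟨ψ, hψ'⟩ := exists_hom_of_right_equivariant (fun g => f₁ g * p g) _ hS (by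
      rintro _ (⟨x, rfl⟩ | ⟨x, rfl⟩)
      · exact ⟨ψ₁ x, fun g => by rw [hf₁, hp, mul_assoc]⟩
      · exact ⟨ψ₂ x, fun g => by simp only [hΦ]; rw [hf₂, hq, mul_assoc]⟩)
    refine ⟨ψ, ?_, ?_⟩
    · ext x
      have := hψ' 1 (i₁ x)
      simp only [hf₁, hp] at this
      rw [← mul_assoc] at this
      exact (mul_left_cancel this).symm
    · ext x
      have := hψ' 1 (i₂ x)
      simp only [hΦ, hf₂, hq] at this
      rw [← mul_assoc] at this
      exact (mul_left_cancel this).symm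
  refine ⟨⟨by rw [← GrpCat.ofHom_comp, ← GrpCat.ofHom_comp, hc]⟩, ⟨?_⟩⟩
  refine Limits.PushoutCocone.IsColimit.mk _ (fun s => GrpCat.ofHom (lift s.pt s.inl.hom s.inr.hom
    (congrArg GrpCat.Hom.hom s.condition)).choose) (fun s => ?_) (fun s => ?_)
    (fun s m h1 h2 => ?_)
  · exact GrpCat.hom_ext (lift s.pt s.inl.hom s.inr.hom
      (congrArg GrpCat.Hom.hom s.condition)).choose_spec.1
  · exact GrpCat.hom_ext (lift s.pt s.inl.hom s.inr.hom
      (congrArg GrpCat.Hom.hom s.condition)).choose_spec.2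
  · have hs := (lift s.pt s.inl.hom s.inr.hom
      (congrArg GrpCat.Hom.hom s.condition)).choose_spec
    exact GrpCat.hom_ext (ext _ _ ((congrArg GrpCat.Hom.hom h1).trans hs.1.symm)
      ((congrArg GrpCat.Hom.hom h2).trans hs.2.symm))

theorem HNN.t_conj {H G : Type u} [Group H] [Group G] (α β : H →* G)
    (hα : Function.Injective α) (hβ : Function.Injective β) (h : H) :
    (HNNExtension.t : HNN α β hα hβ) * HNNExtension.of (α h) =
      HNNExtension.of (β h) * HNNExtension.t := by
  have := HNNExtension.t_mul_of (φ := (MonoidHom.ofInjective hα).symm.trans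
    (MonoidHom.ofInjective hβ)) ⟨α h, h, rfl⟩
  rw [this]
  congr 2
  have e : (MonoidHom.ofInjective hα).symm ⟨α h, h, rfl⟩ = h :=
    (MulEquiv.symm_apply_eq _).2 (Subtype.ext rfl)
  simp [e, MonoidHom.ofInjective_apply]

theorem HNN.exists_lift {H G X : Type u} [Group H] [Group G] [Group X] (α β : H →* G)
    (hα : Function.Injective α) (hβ : Function.Injective β) (ψ : G →* X) (x : X)
    (hx : ∀ h, x * ψ (α h) = ψ (β h) * x) :
    ∃ Ψ : HNN α β hα hβ →* X, (∀ g, Ψ (HNNExtension.of g) = ψ g) ∧ Ψ HNNExtension.t = x := by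
  refine ⟨HNNExtension.lift ψ x ?_, fun g => HNNExtension.lift_of .., HNNExtension.lift_t ..⟩
  rintro ⟨_, h, rfl⟩
  rw [hx]
  congr 2
  have e : (MonoidHom.ofInjective hα).symm ⟨α h, h, rfl⟩ = h :=
    (MulEquiv.symm_apply_eq _).2 (Subtype.ext rfl)
  simp [e, MonoidHom.ofInjective_apply]

/-- A group generated by a subgroup and an element is the corresponding HNN extension as soon as
the cochains of the associated coset graph are coboundaries. -/
theorem nonempty_HNN_mulEquiv_of_cochains {H G Γ : Type u} [Group H] [Group G] [Group Γ]
    (α β : H →* G) (hα : Function.Injective α) (hβ : Function.Injective β)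
    (i : G →* Γ) (hi : Function.Injective i) (k : Γ) (hk : ∀ h, i (α h) * k = k * i (β h))
    (hgen : Subgroup.closure ((i.range : Set Γ) ∪ {k}) = ⊤)
    (h : ∀ (X : Type u) [Group X] (c : Γ → X), (∀ g n, c (g * i (α n)) = c g) →
      ∃ f : Γ → X, (∀ g l, f (g * i l) = f g) ∧ ∀ g, f (g * k) = f g * c g) :
    Nonempty (HNN α β hα hβ ≃* Γ) := by
  -- The relation `hk` says that `k⁻¹` conjugates `α h` to `β h`, so the stable letter corresponds
  -- to `k⁻¹`.
  obtain ⟨Ψ, hΨ, hΨt⟩ := HNN.exists_lift α β hα hβ i k⁻¹ (fun h => by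
    rw [inv_mul_eq_iff_eq_mul, ← mul_assoc, ← hk, mul_inv_cancel_right])
  let X := HNN α β hα hβ
  obtain ⟨p, hp⟩ := exists_right_equivariant i hi (HNNExtension.of : G →* X)
  -- This cochain measures the failure of `p` to turn right multiplication by `k` into
  -- multiplication by `t⁻¹`; a potential `f` corrects `p` to `f * p`.
  obtain ⟨f, hf, hfk⟩ := h X (fun g => p g * HNNExtension.t⁻¹ * (p (g * k))⁻¹) (fun g n => by
    have h1 : (HNNExtension.of (α n) : X) * HNNExtension.t⁻¹ =
        HNNExtension.t⁻¹ * HNNExtension.of (β n) := by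
      rw [eq_inv_mul_iff_mul_eq, ← mul_assoc, HNN.t_conj, mul_inv_cancel_right]
    rw [mul_assoc g, hk, ← mul_assoc g, hp, hp, mul_assoc (p g), h1]
    group)
  obtain ⟨ψ, hψ⟩ := exists_hom_of_right_equivariant (fun g => f g * p g) _ hgen (by
    rintro _ (⟨x, rfl⟩ | rfl)
    · exact ⟨HNNExtension.of x, fun g => by rw [hf, hp, mul_assoc]⟩
    · exact ⟨HNNExtension.t⁻¹, fun g => by rw [hfk]; group⟩)
  have hψi : ∀ x, ψ (i x) = HNNExtension.of x := by
    intro x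
    have := hψ 1 (i x)
    simp only [hf, hp] at this
    rw [← mul_assoc] at this
    exact (mul_left_cancel this).symm
  have hψk : ψ k = HNNExtension.t⁻¹ := by
    have := hψ 1 k
    simp only [hfk] at this
    have h2 : f 1 * p 1 * HNNExtension.t⁻¹ = f 1 * p 1 * ψ k := by rw [← this]; group
    exact (mul_left_cancel h2).symm
  refine ⟨MonoidHom.toMulEquiv Ψ ψ ?_ ?_⟩
  · refine HNNExtension.hom_ext ?_ ?_
    · ext x; simp [hΨ, hψi]
    · simp [hΨt, hψk]
  · refine MonoidHom.eq_of_eqOn_dense hgen ?_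
    rintro _ (⟨x, rfl⟩ | rfl)
    · simp [hΨ, hψi]
    · simp [hΨt, hψk]

end Criteria

/-! ### Isomorphism invariance and directed unions -/

section ClosureProperties

/-- Any group isomorphic to `G` is a pushout of two identity maps of `G`, so isomorphism invariance
is an instance of the amalgam clause. -/
theorem ClBar.of_mulEquiv {G Γ : Type u} [Group G] [Group Γ] (e : G ≃* Γ) (h : ClBar G) :
    ClBar Γ := by
  have : IsIso (GrpCat.ofHom e.toMonoidHom) :=
    (MulEquiv.toGrpIso (X := GrpCat.of G) (Y := GrpCat.of Γ) e).isIso_hom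
  refine GroupClass.amalgam (MonoidHom.id G) (MonoidHom.id G) e.toMonoidHom e.toMonoidHom
    Function.injective_id Function.injective_id ?_ trivial h h h
  have : IsIso (GrpCat.ofHom (MonoidHom.id G)) := inferInstanceAs (IsIso (𝟙 (GrpCat.of G)))
  exact IsPushout.of_horiz_isIso ⟨rfl⟩

theorem ClBar.of_injective {G Γ : Type u} [Group G] [Group Γ] (i : G →* Γ)
    (hi : Function.Injective i) {K : Subgroup Γ} (hK : i.range = K) (h : ClBar G) : ClBar K := by
  subst hK
  exact h.of_mulEquiv (MonoidHom.ofInjective hi)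

theorem ClBar.of_directed {Γ : Type u} [Group Γ] {ι : Type u} [Nonempty ι] (L : Subgroup Γ)
    (K : ι → Subgroup Γ) (hdir : Directed (· ≤ ·) K) (hL : ∀ g, g ∈ L ↔ ∃ i, g ∈ K i)
    (h : ∀ i, ClBar (K i)) : ClBar L := by
  have hle : ∀ i, K i ≤ L := fun i g hg => (hL g).2 ⟨i, hg⟩
  refine GroupClass.union (fun i => (K i).subgroupOf L) (fun i j => ?_) (fun g => ?_) (fun i => ?_)
  · obtain ⟨m, h1, h2⟩ := hdir i j
    exact ⟨m, Subgroup.comap_mono h1, Subgroup.comap_mono h2⟩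
  · obtain ⟨i, hi⟩ := (hL g).1 g.2
    exact ⟨i, hi⟩
  · exact ClBar.of_mulEquiv (Subgroup.subgroupOfEquivOfLe (hle i)).symm (h i)

end ClosureProperties

/-! ### Groups acting on trees with stabilizers in the class -/

section Trees

/-- An oriented graph, with origin and terminus maps `o` and `t`, is a tree if it is connected and
if every cochain on its edges with values in a group is a coboundary. -/
structure IsTree {V E : Type u} (o t : E → V) : Prop where
  nonempty : Nonempty V
  connected : ∀ U : Set V, (∀ e, o e ∈ U ↔ t e ∈ U) → U.Nonempty → U = Set.univ
  coboundary : ∀ (X : Type u) [Group X] (c : E → X), ∃ f : V → X, ∀ e, f (t e) = f (o e) * c e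

theorem IsTree.swap {V E : Type u} {o t : E → V} (h : IsTree o t) : IsTree t o where
  nonempty := h.nonempty
  connected U hU := h.connected U fun e => (hU e).symm
  coboundary X _ c := by
    obtain ⟨f, hf⟩ := h.coboundary X fun e => (c e)⁻¹
    exact ⟨f, fun e => by rw [hf, inv_mul_cancel_right]⟩

/-- The set of vertices `S` spans a connected subgraph. -/
def SpansConnected {V E : Type u} (o t : E → V) (S : Set V) : Prop :=
  ∀ U : Set V, (∀ e, o e ∈ S → t e ∈ S → (o e ∈ U ↔ t e ∈ U)) → ∀ a ∈ S, ∀ b ∈ S, a ∈ U → b ∈ U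

theorem SpansConnected.swap {V E : Type u} {o t : E → V} {S : Set V} (h : SpansConnected o t S) :
    SpansConnected t o S :=
  fun U hU => h U fun e h1 h2 => (hU e h2 h1).symm

theorem SpansConnected.apply_eq {V E : Type u} {Y : Type*} {o t : E → V} {S : Set V}
    (h : SpansConnected o t S) (f : V → Y) (hf : ∀ e, o e ∈ S → t e ∈ S → f (t e) = f (o e))
    {a b : V} (ha : a ∈ S) (hb : b ∈ S) : f b = f a :=
  h {v | f v = f a} (fun e h1 h2 => by simp only [Set.mem_ofPred_eq, hf e h1 h2]) a ha b hb rfl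

/-- A nonempty set of vertices spanning a connected subgraph, disjoint from its translates, and
whose stabilizer belongs to the class. -/
structure IsGoodBlock {V E : Type u} (o t : E → V) (K : Type u) [Group K] [MulAction K V]
    (S : Set V) : Prop where
  nonempty : S.Nonempty
  spansConnected : SpansConnected o t S
  smul_mem : ∀ (k : K), ∀ s ∈ S, k • s ∈ S → ∀ v ∈ S, k • v ∈ S
  clBar : ∀ L : Subgroup K, (∀ k, k ∈ L ↔ ∃ s ∈ S, k • s ∈ S) → ClBar L

variable {V E K : Type u} [Group K] [MulAction K V] {o t : E → V}

/-- The stabilizer of a block. -/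
def blockStabilizer (K : Type u) [Group K] [MulAction K V] {S : Set V} (hne : S.Nonempty)
    (hS : ∀ (k : K), ∀ s ∈ S, k • s ∈ S → ∀ v ∈ S, k • v ∈ S) : Subgroup K where
  carrier := {k | ∃ s ∈ S, k • s ∈ S}
  one_mem' := ⟨hne.some, hne.some_mem, by simpa using hne.some_mem⟩
  mul_mem' := by
    rintro a b ⟨s, hs, has⟩ ⟨r, hr, hbr⟩
    exact ⟨r, hr, by rw [mul_smul]; exact hS a s hs has _ hbr⟩
  inv_mem' := by
    rintro a ⟨s, hs, has⟩
    exact ⟨a • s, has, by simpa using hs⟩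

theorem IsGoodBlock.swap {S : Set V} (h : IsGoodBlock o t K S) : IsGoodBlock t o K S :=
  ⟨h.nonempty, h.spansConnected.swap, h.smul_mem, h.clBar⟩

theorem isGoodBlock_singleton (hV : ∀ v : V, ClBar (MulAction.stabilizer K v)) (v : V) :
    IsGoodBlock o t K {v} where
  nonempty := Set.singleton_nonempty v
  spansConnected := by rintro U - a rfl b rfl h; exact h
  smul_mem := by rintro k _ rfl h _ rfl; exact h
  clBar L hL := by
    have : L = MulAction.stabilizer K v := by
      ext k; simp [hL, MulAction.mem_stabilizer_iff]
    exact this ▸ hV v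

/-- The chain condition for Zorn's lemma. The stabilizer of the union is the directed union of the
stabilizers, which is where stability under filtered unions enters. -/
theorem isGoodBlock_sUnion {c : Set (Set V)} (hne : c.Nonempty) (hc : IsChain (· ⊆ ·) c)
    (h : ∀ S ∈ c, IsGoodBlock o t K S) : IsGoodBlock o t K (⋃₀ c) := by
  have hdir : ∀ S ∈ c, ∀ T ∈ c, ∃ R ∈ c, S ⊆ R ∧ T ⊆ R := by
    intro S hS T hT
    rcases hc.total hS hT with h | h
    · exact ⟨T, hT, h, subset_rfl⟩
    · exact ⟨S, hS, subset_rfl, h⟩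
  have hsm : ∀ (k : K), ∀ s ∈ ⋃₀ c, k • s ∈ ⋃₀ c → ∃ R ∈ c, s ∈ R ∧ k • s ∈ R := by
    rintro k s ⟨S, hS, hs⟩ ⟨T, hT, ht⟩
    obtain ⟨R, hR, h1, h2⟩ := hdir S hS T hT
    exact ⟨R, hR, h1 hs, h2 ht⟩
  refine ⟨?_, ?_, ?_, ?_⟩
  · obtain ⟨S, hS⟩ := hne
    obtain ⟨s, hs⟩ := (h S hS).nonempty
    exact ⟨s, S, hS, hs⟩
  · rintro U hU a ⟨S, hS, ha⟩ b ⟨T, hT, hb⟩ haU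
    obtain ⟨R, hR, h1, h2⟩ := hdir S hS T hT
    exact (h R hR).spansConnected U (fun e h1 h2 => hU e ⟨R, hR, h1⟩ ⟨R, hR, h2⟩) a (h1 ha) b
      (h2 hb) haU
  · rintro k s hs hks v ⟨T, hT, hv⟩
    obtain ⟨S, hS, h1, h2⟩ := hsm k s hs hks
    obtain ⟨R, hR, h3, h4⟩ := hdir S hS T hT
    exact ⟨R, hR, (h R hR).smul_mem k s (h3 h1) (h3 h2) v (h4 hv)⟩
  · intro L hL
    have : Nonempty c := hne.to_subtype
    refine ClBar.of_directed L
      (fun S : c => blockStabilizer K (h S S.2).nonempty (h S S.2).smul_mem) ?_ ?_ ?_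
    · rintro ⟨S, hS⟩ ⟨T, hT⟩
      obtain ⟨R, hR, h3, h4⟩ := hdir S hS T hT
      refine ⟨⟨R, hR⟩, ?_, ?_⟩
      · rintro k ⟨s, hs, hks⟩
        exact ⟨s, h3 hs, h3 hks⟩
      · rintro k ⟨s, hs, hks⟩
        exact ⟨s, h4 hs, h4 hks⟩
    · intro k
      rw [hL]
      constructor
      · rintro ⟨s, hs, hks⟩
        obtain ⟨R, hR, h1, h2⟩ := hsm k s hs hks
        exact ⟨⟨R, hR⟩, s, h1, h2⟩
      · rintro ⟨⟨R, hR⟩, s, h1, h2⟩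
        exact ⟨s, ⟨R, hR, h1⟩, R, hR, h2⟩
    · rintro ⟨S, hS⟩
      exact (h S hS).clBar _ fun k => Iff.rfl

variable [MulAction K E]

/-- On a tree, a function `c` on a group whose values only depend on the image of an edge leaving
a block is the variation along this edge of a function constant on the translates of the block. -/
theorem IsTree.exists_constant_on_translates (hT : IsTree o t)
    (ho : ∀ (k : K) e, o (k • e) = k • o e) (ht : ∀ (k : K) e, t (k • e) = k • t e)
    {S : Set V} (hS : SpansConnected o t S)
    (hsm : ∀ (k : K), ∀ s ∈ S, k • s ∈ S → ∀ v ∈ S, k • v ∈ S)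
    {e : E} (hoe : o e ∈ S) (hte : t e ∉ S) {X : Type u} [Group X] (L : Subgroup K) (c : L → X)
    (hc : ∀ x y : L, (x : K) • e = (y : K) • e → c x = c y) :
    ∃ f : V → X, (∀ x : L, ∀ a ∈ S, ∀ b ∈ S, f ((x : K) • a) = f ((x : K) • b)) ∧
      ∀ x : L, f ((x : K) • t e) = f ((x : K) • o e) * c x := by
  classical
  -- The cochain carries `c` on the `L`-orbit of `e` and is trivial elsewhere; `hc` makes the choice
  -- harmless.
  let d : E → X := fun e' => if h : ∃ x : L, (x : K) • e = e' then c h.choose else 1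
  have hd : ∀ x : L, d ((x : K) • e) = c x := by
    intro x
    have h : ∃ y : L, (y : K) • e = (x : K) • e := ⟨x, rfl⟩
    simp only [d, dif_pos h]
    exact hc _ _ h.choose_spec
  obtain ⟨f, hf⟩ := hT.coboundary X d
  refine ⟨f, fun x a ha b hb => ?_, fun x => by rw [← ho, ← ht, hf, hd]⟩
  refine hS.apply_eq (fun v => f ((x : K) • v)) (fun e' h1 h2 => ?_) hb ha
  -- An edge inside a translate of `S` is not in the orbit of `e`: otherwise some translate of `e`
  -- would have both ends in `S`, and the block property would force `t e ∈ S`.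
  have h3 : d ((x : K) • e') = 1 := by
    refine dif_neg ?_
    rintro ⟨y, hy⟩
    have hy' : e' = ((x : K)⁻¹ * y) • e := by rw [mul_smul, hy, inv_smul_smul]
    rw [hy', ho] at h1
    rw [hy', ht] at h2
    have := hsm ((x : K)⁻¹ * y)⁻¹ _ h1 (by rwa [inv_smul_smul]) _ h2
    rw [inv_smul_smul] at this
    exact hte this
  have := hf ((x : K) • e')
  rwa [h3, mul_one, ho, ht] at this

/-- The translates of a block and of the end of an edge leaving it form a block, if they are
connected by a generating set of the group of translations. -/
theorem IsGoodBlock.translates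
    (ho : ∀ (k : K) e, o (k • e) = k • o e) (ht : ∀ (k : K) e, t (k • e) = k • t e)
    {S : Set V} (hS : IsGoodBlock o t K S) {e : E} (hoe : o e ∈ S) (R : Set K)
    (hR : ∀ x ∈ R, x • o e ∈ S ∨ x • t e = t e ∨ ∃ s ∈ S, x • s = t e)
    (hQ : ∀ x : K, ∀ a ∈ insert (t e) S, x • a ∈ insert (t e) S → x ∈ Subgroup.closure R)
    (hcl : ClBar (Subgroup.closure R)) :
    ∃ S', S ⊆ S' ∧ t e ∈ S' ∧ IsGoodBlock o t K S' := by
  set Q := Subgroup.closure R with hQR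
  -- By `hQ`, an element moving a point of `S'` into `S'` lies in `Q`, so `S'` is a block with
  -- stabilizer exactly `Q`.
  let S' : Set V := {v | ∃ q ∈ Q, ∃ a ∈ insert (t e) S, v = q • a}
  have hSS' : S ⊆ S' := fun s hs => ⟨1, Q.one_mem, s, Or.inr hs, (one_smul _ _).symm⟩
  have hQS' : ∀ q ∈ Q, ∀ v ∈ S', q • v ∈ S' := by
    rintro q hq _ ⟨r, hr, a, ha, rfl⟩
    exact ⟨q * r, Q.mul_mem hq hr, a, ha, (mul_smul _ _ _).symm⟩
  have hwS' : t e ∈ S' := ⟨1, Q.one_mem, t e, Or.inl rfl, (one_smul _ _).symm⟩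
  have hkey : ∀ k : K, ∀ s ∈ S', k • s ∈ S' → k ∈ Q := by
    rintro k _ ⟨q, hq, a, ha, rfl⟩ ⟨r, hr, b, hb, h⟩
    have h' : (r⁻¹ * k * q) • a = b := by
      rw [mul_smul, mul_smul, h, inv_smul_smul]
    have h2 := Q.mul_mem (Q.mul_mem hr (hQ _ a ha (h' ▸ hb))) (Q.inv_mem hq)
    have h3 : r * (r⁻¹ * k * q) * q⁻¹ = k := by group
    rwa [h3] at h2
  refine ⟨S', hSS', hwS', ⟨_, hwS'⟩, ?_, ?_, ?_⟩
  · intro U hU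
    have htr : ∀ q ∈ Q, ∀ a ∈ S, ∀ b ∈ S, q • a ∈ U → q • b ∈ U := by
      intro q hq a ha b hb
      refine hS.spansConnected {v | q • v ∈ U} (fun e' h1 h2 => ?_) a ha b hb
      have := hU (q • e') (by rw [ho]; exact hQS' q hq _ (hSS' h1))
        (by rw [ht]; exact hQS' q hq _ (hSS' h2))
      rwa [ho, ht] at this
    have hed : ∀ q ∈ Q, (q • o e ∈ U ↔ q • t e ∈ U) := by
      intro q hq
      have := hU (q • e) (by rw [ho]; exact hQS' q hq _ (hSS' hoe))
        (by rw [ht]; exact hQS' q hq _ hwS')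
      rwa [ho, ht] at this
    -- Connectedness is propagated along words in `R`. By `hR`, for a generator `x` the points `x •
    -- o e` and `o e` are joined through `S`, through the fixed vertex `t e`, or through a point of
    -- `S` that `x` carries to `t e`.
    have hgen : ∀ x ∈ Q, ∀ q ∈ Q, (q • x • o e ∈ U ↔ q • o e ∈ U) := by
      intro x hx
      induction hx using Subgroup.closure_induction with
      | mem x hx =>
        intro q hq
        have hqx : q * x ∈ Q := Q.mul_mem hq (Subgroup.subset_closure hx)
        rcases hR x hx with h | h | ⟨s, hs, h⟩
        · exact ⟨htr q hq _ h _ hoe, htr q hq _ hoe _ h⟩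
        · have h1 := hed (q * x) hqx
          rw [mul_smul, mul_smul, h] at h1
          exact h1.trans (hed q hq).symm
        · rw [hed q hq, ← h, ← mul_smul, ← mul_smul]
          exact ⟨htr _ hqx _ hoe _ hs, htr _ hqx _ hs _ hoe⟩
      | one => intro q hq; rw [one_smul]
      | mul x y hx hy h1 h2 =>
        intro q hq
        rw [mul_smul, ← h1 q hq]
        have := h2 (q * x) (Q.mul_mem hq hx)
        rwa [mul_smul, mul_smul] at this
      | inv x hx h1 =>
        intro q hq
        have := h1 (q * x⁻¹) (Q.mul_mem hq (Q.inv_mem hx))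
        rw [mul_smul, mul_smul, inv_smul_smul] at this
        exact this.symm
    have hall : ∀ a ∈ S', (a ∈ U ↔ o e ∈ U) := by
      rintro _ ⟨q, hq, a, ha, rfl⟩
      have h1 := hgen q hq 1 Q.one_mem
      rw [one_smul, one_smul] at h1
      rw [← h1]
      rcases ha with rfl | ha
      · exact (hed q hq).symm
      · exact ⟨htr q hq _ ha _ hoe, htr q hq _ hoe _ ha⟩
    intro a ha b hb
    rw [hall a ha, hall b hb]
    exact id
  · intro k s hs hks v hv
    exact hQS' k (hkey k s hs hks) v hv
  · intro Q' hQ'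
    have : Q' = Q := by
      ext k
      rw [hQ']
      exact ⟨fun ⟨s, hs, hks⟩ => hkey k s hs hks, fun hk => ⟨t e, hwS', hQS' k hk _ hwS'⟩⟩
    exact this ▸ hcl

/-- The new vertex lies in no translate of `S`, so the enlarged block has stabilizer `L *_N M`, with
`L`, `M`, `N` the stabilizers of `S`, `t e`, `e`. The potentials required by `isPushout_of_cochains`
are the values of one tree potential at the two ends of the translates of `e`. -/
theorem IsGoodBlock.exists_amalgam (hT : IsTree o t)
    (ho : ∀ (k : K) e, o (k • e) = k • o e) (ht : ∀ (k : K) e, t (k • e) = k • t e)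
    (hV : ∀ v : V, ClBar (MulAction.stabilizer K v))
    (hE : ∀ e : E, ClBar (MulAction.stabilizer K e))
    {S : Set V} (hS : IsGoodBlock o t K S) {e : E} (hoe : o e ∈ S)
    (hnew : ∀ k : K, t e ∉ (fun v => k • v) '' S) :
    ∃ S', S ⊆ S' ∧ t e ∈ S' ∧ IsGoodBlock o t K S' := by
  set w := t e with hw
  have hwS : w ∉ S := fun h => hnew 1 ⟨w, h, one_smul _ _⟩
  let L := blockStabilizer K hS.nonempty hS.smul_mem
  have hLS : ∀ l ∈ L, ∀ s ∈ S, l • s ∈ S := by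
    rintro l ⟨s, hs, hls⟩ v hv
    exact hS.smul_mem l s hs hls v hv
  let M := MulAction.stabilizer K w
  let N := MulAction.stabilizer K e
  have hNL : N ≤ L := fun n hn =>
    ⟨o e, hoe, by rw [← ho, MulAction.mem_stabilizer_iff.1 hn]; exact hoe⟩
  have hNM : N ≤ M := fun n hn => by
    rw [MulAction.mem_stabilizer_iff, hw, ← ht, MulAction.mem_stabilizer_iff.1 hn]
  let Q := Subgroup.closure ((L : Set K) ∪ M)
  have hLQ : L ≤ Q := fun l hl => Subgroup.subset_closure (Or.inl hl)
  have hMQ : M ≤ Q := fun m hm => Subgroup.subset_closure (Or.inr hm)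
  refine hS.translates ho ht hoe ((L : Set K) ∪ M) (fun x hx => ?_) (fun x a ha hxa => ?_) ?_
  · exact hx.imp (fun hx => hLS x hx _ hoe) fun hx => Or.inl hx
  · rcases ha with rfl | ha <;> rcases hxa with hb | hb
    · exact hMQ hb
    · exact absurd ⟨_, hb, inv_smul_smul _ _⟩ (hnew x⁻¹)
    · exact absurd ⟨a, ha, hb⟩ (hnew x)
    · exact hLQ ⟨a, ha, hb⟩
  · show ClBar Q
    refine GroupClass.amalgam (Subgroup.inclusion hNL) (Subgroup.inclusion hNM)
      (Subgroup.inclusion hLQ) (Subgroup.inclusion hMQ)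
      (Subgroup.inclusion_injective _) (Subgroup.inclusion_injective _) ?_ trivial
      (hE e) (hS.clBar L fun _ => Iff.rfl) (hV w)
    refine isPushout_of_cochains _ _ _ _ (Subgroup.inclusion_injective _)
      (Subgroup.inclusion_injective _) rfl ?_ ?_
    · have hQ : L ⊔ M = Q := Subgroup.sup_eq_closure L M
      rw [Subgroup.inclusion_range, Subgroup.inclusion_range, ← Subgroup.subgroupOf_sup hLQ hMQ,
        hQ, Subgroup.subgroupOf_self]
    · intro X _ c hc
      obtain ⟨f, hf1, hf2⟩ := hT.exists_constant_on_translates ho ht hS.spansConnected hS.smul_mem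
        hoe hwS (L := Q) c (fun x y hxy => by
          have hn : (y : K)⁻¹ * x ∈ N := by
            rw [MulAction.mem_stabilizer_iff, mul_smul, hxy, inv_smul_smul]
          have := hc y ⟨_, hn⟩
          rw [← this]
          congr 1
          ext
          simp)
      refine ⟨fun x => f ((x : K) • o e), fun x => f ((x : K) • w), fun g l => ?_, fun g m => ?_,
        hf2⟩
      · have := hf1 g _ (hLS l l.2 _ hoe) _ hoe
        rw [← mul_smul] at this
        exact this
      · show f (((g : K) * m) • w) = _
        rw [mul_smul, show (m : K) • w = w from m.2]

/-- Here `e` joins `S` to its translate by `k`, so no new vertex group appears: the stabilizer grows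
to the HNN extension generated by `L` and `k`, where `N` embeds in `L` by inclusion and by
conjugation by `k`. -/
theorem IsGoodBlock.exists_hnn (hT : IsTree o t)
    (ho : ∀ (k : K) e, o (k • e) = k • o e) (ht : ∀ (k : K) e, t (k • e) = k • t e)
    (hE : ∀ e : E, ClBar (MulAction.stabilizer K e))
    {S : Set V} (hS : IsGoodBlock o t K S) {e : E} (hoe : o e ∈ S) (hwS : t e ∉ S)
    {k : K} {s' : V} (hs' : s' ∈ S) (hk : k • s' = t e) :
    ∃ S', S ⊆ S' ∧ t e ∈ S' ∧ IsGoodBlock o t K S' := by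
  set w := t e with hw
  let L := blockStabilizer K hS.nonempty hS.smul_mem
  have hLS : ∀ l ∈ L, ∀ s ∈ S, l • s ∈ S := by
    rintro l ⟨s, hs, hls⟩ v hv
    exact hS.smul_mem l s hs hls v hv
  let N := MulAction.stabilizer K e
  have hNL : N ≤ L := fun n hn =>
    ⟨o e, hoe, by rw [← ho, MulAction.mem_stabilizer_iff.1 hn]; exact hoe⟩
  have hNL' : ∀ n ∈ N, k⁻¹ * n * k ∈ L := fun n hn => ⟨s', hs', by
    have : n • w = w := by rw [hw, ← ht, MulAction.mem_stabilizer_iff.1 hn]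
    rw [mul_smul, mul_smul, hk, this, ← hk, inv_smul_smul]
    exact hs'⟩
  let Q := Subgroup.closure ((L : Set K) ∪ {k})
  have hLQ : L ≤ Q := fun l hl => Subgroup.subset_closure (Or.inl hl)
  have hkQ : k ∈ Q := Subgroup.subset_closure (Or.inr rfl)
  refine hS.translates ho ht hoe ((L : Set K) ∪ {k}) (fun x hx => ?_) (fun x a ha hxa => ?_) ?_
  · exact hx.imp (fun hx => hLS x hx _ hoe) fun hx => Or.inr ⟨s', hs', by rw [hx, hk]⟩
  -- The end of `e` is itself a `Q`-translate of a point of `S`, so everything reduces to the block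
  -- property of `S`.
  · have hrep : ∀ a ∈ insert w S, ∃ q ∈ Q, ∃ s ∈ S, a = q • s := by
      rintro a (rfl | ha)
      · exact ⟨k, hkQ, s', hs', hk.symm⟩
      · exact ⟨1, Q.one_mem, a, ha, (one_smul _ _).symm⟩
    obtain ⟨q, hq, s, hs, rfl⟩ := hrep a ha
    obtain ⟨r, hr, b, hb, h⟩ := hrep _ hxa
    have h' : (r⁻¹ * x * q) • s = b := by
      rw [mul_smul, mul_smul, h, inv_smul_smul]
    have h2 := Q.mul_mem (Q.mul_mem hr (hLQ ⟨s, hs, h' ▸ hb⟩)) (Q.inv_mem hq)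
    have h3 : r * (r⁻¹ * x * q) * q⁻¹ = x := by group
    rwa [h3] at h2
  · show ClBar Q
    let β : N →* L := MonoidHom.mk' (fun n => ⟨k⁻¹ * n * k, hNL' n n.2⟩)
      (fun a b => by ext; simp only [Subgroup.coe_mul]; group)
    have hβ : Function.Injective β := by
      intro a b hab
      have : k⁻¹ * a * k = k⁻¹ * b * k := congrArg Subtype.val hab
      exact Subtype.ext (mul_left_cancel (mul_right_cancel this))
    obtain ⟨eq⟩ := nonempty_HNN_mulEquiv_of_cochains (Subgroup.inclusion hNL) β
      (Subgroup.inclusion_injective _) hβ (Subgroup.inclusion hLQ)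
      (Subgroup.inclusion_injective _) ⟨k, hkQ⟩ (fun n => by
        ext
        show (n : K) * k = k * (k⁻¹ * n * k)
        group) (by
        have := Subgroup.closure_closure_coe_preimage (k := (L : Set K) ∪ {k})
        rw [← this]
        congr 1
        ext x
        rw [Subgroup.inclusion_range]
        simp [Subgroup.mem_subgroupOf, Subtype.ext_iff]) (by
        intro X _ c hc
        obtain ⟨f, hf1, hf2⟩ := hT.exists_constant_on_translates ho ht hS.spansConnected
          hS.smul_mem hoe hwS (L := Q) c (fun x y hxy => by
            have hn : (y : K)⁻¹ * x ∈ N := by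
              rw [MulAction.mem_stabilizer_iff, mul_smul, hxy, inv_smul_smul]
            have := hc y ⟨_, hn⟩
            rw [← this]
            congr 1
            ext
            simp)
        refine ⟨fun x => f ((x : K) • o e), fun g l => ?_, fun g => ?_⟩
        · have := hf1 g _ (hLS l l.2 _ hoe) _ hoe
          rw [← mul_smul] at this
          exact this
        · rw [← hf2 g, ← hw, ← hk, ← mul_smul]
          exact hf1 (g * ⟨k, hkQ⟩) _ hoe _ hs')
    exact GroupClass.hnn _ _ _ _ eq trivial (hE e) (hS.clBar L fun _ => Iff.rfl)

/-- A group acting on a tree with vertex and edge stabilizers in the class is in the class. -/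
theorem IsTree.clBar (hT : IsTree o t)
    (ho : ∀ (k : K) e, o (k • e) = k • o e) (ht : ∀ (k : K) e, t (k • e) = k • t e)
    (hV : ∀ v : V, ClBar (MulAction.stabilizer K v))
    (hE : ∀ e : E, ClBar (MulAction.stabilizer K e)) : ClBar K := by
  obtain ⟨v⟩ := hT.nonempty
  obtain ⟨S, -, hS⟩ := zorn_subset_nonempty {S | IsGoodBlock o t K S}
    (fun c hc hchain hne => ⟨⋃₀ c, isGoodBlock_sUnion hne hchain hc,
      fun _ => Set.subset_sUnion_of_mem⟩) {v} (isGoodBlock_singleton hV v)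
  have hgood : IsGoodBlock o t K S := hS.prop
  -- Stated for arbitrary orientation maps, because an edge at the boundary of `S` may point
  -- inwards; that case is applied to the reversed tree.
  have hext : ∀ {o t : E → V} (_ : IsTree o t) (_ : ∀ (k : K) e, o (k • e) = k • o e)
      (_ : ∀ (k : K) e, t (k • e) = k • t e) (_ : IsGoodBlock o t K S) (e : E), o e ∈ S → t e ∉ S →
      ∃ S', S ⊆ S' ∧ t e ∈ S' ∧ IsGoodBlock o t K S' := by
    intro o t hT ho ht hgood e h1 h2
    by_cases hnew : ∀ k : K, t e ∉ (fun v => k • v) '' S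
    · exact hgood.exists_amalgam hT ho ht hV hE h1 hnew
    · push Not at hnew
      obtain ⟨k, s', hs', hk⟩ := hnew
      exact hgood.exists_hnn hT ho ht hE h1 h2 hs' hk
  have huniv : S = Set.univ := by
    refine hT.connected S (fun e => ⟨fun h1 => ?_, fun h1 => ?_⟩) hgood.nonempty
    · by_contra h2
      obtain ⟨S', h3, h4, h5⟩ := hext hT ho ht hgood e h1 h2
      exact h2 (hS.le_of_ge h5 h3 h4)
    · by_contra h2
      obtain ⟨S', h3, h4, h5⟩ := hext hT.swap ht ho hgood.swap e h1 h2
      exact h2 (hS.le_of_ge h5.swap h3 h4)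
  refine ClBar.of_mulEquiv Subgroup.topEquiv (hgood.clBar ⊤ fun k => ?_)
  simp [huniv, hT.nonempty]

end Trees

/-! ### Wreath products, which turn cochains into morphisms -/

section Wreath

/-- The action of a group by right translations on the functions it carries. -/
def rightTranslation (Γ X : Type u) [Group Γ] [Group X] : Γ →* MulAut (Γ → X) where
  toFun g :=
    { toFun := fun F x => F (x * g)
      invFun := fun F x => F (x * g⁻¹)
      left_inv := fun F => by ext x; simp
      right_inv := fun F => by ext x; simp
      map_mul' := fun _ _ => rfl }
  map_one' := by ext F x; simp
  map_mul' a b := by ext F x; simp [mul_assoc]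

/-- The unrestricted wreath product of `X` and `Γ`. -/
abbrev Wreath (Γ X : Type u) [Group Γ] [Group X] : Type u :=
  (Γ → X) ⋊[rightTranslation Γ X] Γ

variable {Γ X : Type u} [Group Γ] [Group X]

@[simp]
theorem rightTranslation_apply (g : Γ) (F : Γ → X) (x : Γ) :
    rightTranslation Γ X g F x = F (x * g) := rfl

/-- The function part of a splitting is a cocycle. Its evaluation at `x = 1` gives the potentials on
the coset trees. -/
theorem Wreath.left_map_mul (Θ : Γ →* Wreath Γ X) (hΘ : ∀ g, (Θ g).right = g) (g h x : Γ) :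
    (Θ (g * h)).left x = (Θ g).left x * (Θ h).left (x * g) := by
  rw [map_mul, SemidirectProduct.mul_left, hΘ]
  rfl

end Wreath

/-! ### Universal property, generation and injectivity for amalgams -/

section PushoutLemmas

variable {H G₁ G₂ Γ : Type u} [Group H] [Group G₁] [Group G₂] [Group Γ]
  {α : H →* G₁} {β : H →* G₂} {i₁ : G₁ →* Γ} {i₂ : G₂ →* Γ}

theorem isPushout_exists_lift
    (hΓ : IsPushout (GrpCat.ofHom α) (GrpCat.ofHom β) (GrpCat.ofHom i₁) (GrpCat.ofHom i₂))
    {X : Type u} [Group X] (ψ₁ : G₁ →* X) (ψ₂ : G₂ →* X) (h : ∀ x, ψ₁ (α x) = ψ₂ (β x)) :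
    ∃ ψ : Γ →* X, (∀ x, ψ (i₁ x) = ψ₁ x) ∧ ∀ x, ψ (i₂ x) = ψ₂ x := by
  have hw : GrpCat.ofHom α ≫ GrpCat.ofHom ψ₁ = GrpCat.ofHom β ≫ GrpCat.ofHom ψ₂ :=
    GrpCat.hom_ext (MonoidHom.ext h)
  exact ⟨(hΓ.desc _ _ hw).hom,
    fun x => DFunLike.congr_fun (congrArg GrpCat.Hom.hom (hΓ.inl_desc _ _ hw)) x,
    fun x => DFunLike.congr_fun (congrArg GrpCat.Hom.hom (hΓ.inr_desc _ _ hw)) x⟩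

theorem isPushout_hom_ext
    (hΓ : IsPushout (GrpCat.ofHom α) (GrpCat.ofHom β) (GrpCat.ofHom i₁) (GrpCat.ofHom i₂))
    {X : Type u} [Group X] {a b : Γ →* X} (h₁ : ∀ x, a (i₁ x) = b (i₁ x))
    (h₂ : ∀ x, a (i₂ x) = b (i₂ x)) : a = b := by
  have : GrpCat.ofHom a = GrpCat.ofHom b :=
    hΓ.hom_ext (GrpCat.hom_ext (MonoidHom.ext h₁)) (GrpCat.hom_ext (MonoidHom.ext h₂))
  exact congrArg GrpCat.Hom.hom this

theorem isPushout_apply_eq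
    (hΓ : IsPushout (GrpCat.ofHom α) (GrpCat.ofHom β) (GrpCat.ofHom i₁) (GrpCat.ofHom i₂))
    (x : H) : i₁ (α x) = i₂ (β x) :=
  DFunLike.congr_fun (congrArg GrpCat.Hom.hom hΓ.w) x

/-- The universal property gives a map from `Γ` to the generated subgroup whose composite with the
inclusion is the identity, so the inclusion is onto. -/
theorem isPushout_closure_eq_top
    (hΓ : IsPushout (GrpCat.ofHom α) (GrpCat.ofHom β) (GrpCat.ofHom i₁) (GrpCat.ofHom i₂)) :
    Subgroup.closure ((i₁.range : Set Γ) ∪ i₂.range) = ⊤ := by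
  set R := Subgroup.closure ((i₁.range : Set Γ) ∪ i₂.range) with hR
  obtain ⟨ψ, h1, h2⟩ := isPushout_exists_lift hΓ
    (i₁.codRestrict R fun x => Subgroup.subset_closure (Or.inl ⟨x, rfl⟩))
    (i₂.codRestrict R fun x => Subgroup.subset_closure (Or.inr ⟨x, rfl⟩))
    (fun x => Subtype.ext (isPushout_apply_eq hΓ x))
  have : R.subtype.comp ψ = MonoidHom.id Γ :=
    isPushout_hom_ext hΓ (fun x => by simp [h1]) (fun x => by simp [h2])
  refine (Subgroup.eq_top_iff' R).2 fun g => ?_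
  have h3 := DFunLike.congr_fun this g
  have h4 : ((ψ g : R) : Γ) = g := h3
  exact h4 ▸ (ψ g).2

/-- Two groups, as a family of groups. -/
def groupPair (G₁ G₂ : Type u) [Group G₁] [Group G₂] : Bool → GrpCat.{u}
  | true => GrpCat.of G₁
  | false => GrpCat.of G₂

/-- The abstract pushout maps to the concrete `Monoid.PushoutI`, whose factor maps are known to be
injective. -/
theorem isPushout_injective
    (hα : Function.Injective α) (hβ : Function.Injective β)
    (hΓ : IsPushout (GrpCat.ofHom α) (GrpCat.ofHom β) (GrpCat.ofHom i₁) (GrpCat.ofHom i₂)) :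
    Function.Injective i₁ ∧ Function.Injective i₂ := by
  let φ : ∀ b, H →* groupPair G₁ G₂ b := fun b => match b with
    | true => α
    | false => β
  have hφ : ∀ b, Function.Injective (φ b) := fun b => match b with
    | true => hα
    | false => hβ
  obtain ⟨ψ, h1, h2⟩ := isPushout_exists_lift hΓ
    (X := Monoid.PushoutI φ) (Monoid.PushoutI.of (φ := φ) true) (Monoid.PushoutI.of (φ := φ) false)
    (fun x => (Monoid.PushoutI.of_apply_eq_base φ true x).trans
      (Monoid.PushoutI.of_apply_eq_base φ false x).symm)
  constructor
  · intro x y hxy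
    refine Monoid.PushoutI.of_injective hφ true ?_
    exact (h1 x).symm.trans ((congrArg ψ hxy).trans (h1 y))
  · intro x y hxy
    refine Monoid.PushoutI.of_injective hφ false ?_
    exact (h2 x).symm.trans ((congrArg ψ hxy).trans (h2 y))

end PushoutLemmas

/-! ### Coset trees of amalgams and HNN extensions -/

section BassSerreTrees

variable {H G₁ G₂ Γ : Type u} [Group H] [Group G₁] [Group G₂] [Group Γ]

/-- The map from the cosets of `A` to the cosets of `B` induced by the right multiplication by
an element conjugating `A` into `B`. -/
def cosetMap {A B : Subgroup Γ} (x : Γ) (h : ∀ a ∈ A, x⁻¹ * a * x ∈ B) : Γ ⧸ A → Γ ⧸ B :=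
  Quotient.map' (fun g => g * x) fun a b hab => by
    rw [QuotientGroup.leftRel_apply] at hab ⊢
    have := h _ hab
    simpa [mul_assoc] using this

@[simp]
theorem cosetMap_mk {A B : Subgroup Γ} (x : Γ) (h : ∀ a ∈ A, x⁻¹ * a * x ∈ B) (g : Γ) :
    cosetMap x h (QuotientGroup.mk g) = QuotientGroup.mk (g * x) := rfl

theorem cosetMap_smul {A B : Subgroup Γ} (x : Γ) (h : ∀ a ∈ A, x⁻¹ * a * x ∈ B) (k : Γ)
    (e : Γ ⧸ A) : cosetMap x h (k • e) = k • cosetMap x h e := by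
  induction e using QuotientGroup.induction_on with
  | H g => exact congrArg QuotientGroup.mk (mul_assoc k g x)

variable {α : H →* G₁} {β : H →* G₂} {i₁ : G₁ →* Γ} {i₂ : G₂ →* Γ}

/-- The graph on which an amalgamated product acts is a tree. -/
theorem isTree_of_isPushout
    (hΓ : IsPushout (GrpCat.ofHom α) (GrpCat.ofHom β) (GrpCat.ofHom i₁) (GrpCat.ofHom i₂))
    (h1 : ∀ a ∈ (i₁.comp α).range, (1 : Γ)⁻¹ * a * 1 ∈ i₁.range)
    (h2 : ∀ a ∈ (i₁.comp α).range, (1 : Γ)⁻¹ * a * 1 ∈ i₂.range) :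
    IsTree (V := (Γ ⧸ i₁.range) ⊕ (Γ ⧸ i₂.range)) (E := Γ ⧸ (i₁.comp α).range)
      (fun e => Sum.inl (cosetMap 1 h1 e)) (fun e => Sum.inr (cosetMap 1 h2 e)) where
  nonempty := ⟨Sum.inl (QuotientGroup.mk 1)⟩
  connected U hU hne := by
    have hU' : ∀ g : Γ, Sum.inl (QuotientGroup.mk g) ∈ U ↔ Sum.inr (QuotientGroup.mk g) ∈ U := by
      intro g
      simpa using hU (QuotientGroup.mk g)
    have key : ∀ x g : Γ, (Sum.inl (QuotientGroup.mk (g * x)) ∈ U ↔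
        Sum.inl (QuotientGroup.mk g) ∈ U) := by
      intro x
      have hx : x ∈ Subgroup.closure ((i₁.range : Set Γ) ∪ i₂.range) :=
        isPushout_closure_eq_top hΓ ▸ Subgroup.mem_top x
      induction hx using Subgroup.closure_induction with
      | mem x hx =>
        intro g
        rcases hx with hx | hx
        · rw [QuotientGroup.mk_mul_of_mem g hx]
        · rw [hU', hU', QuotientGroup.mk_mul_of_mem g hx]
      | one => simp
      | mul x y _ _ hx hy => intro g; rw [← mul_assoc, hy, hx]
      | inv x _ hx => intro g; rw [← hx, inv_mul_cancel_right]
    have hall : ∀ v, (v ∈ U ↔ Sum.inl (QuotientGroup.mk 1) ∈ U) := by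
      rintro (v | v) <;> induction v using QuotientGroup.induction_on with
      | H g =>
        have := key g 1
        rw [one_mul] at this
        first | exact this | exact (hU' g).symm.trans this
    obtain ⟨v, hv⟩ := hne
    ext w
    simp [hall w, (hall v).1 hv]
  coboundary X _ c := by
    let C : Γ → X := fun g => c (QuotientGroup.mk g)
    have hC : ∀ g h, C (g * i₁ (α h)) = C g := fun g h =>
      congrArg c (QuotientGroup.mk_mul_of_mem g ⟨h, rfl⟩)
    let w : Wreath Γ X := SemidirectProduct.inl C
    -- The standard embedding on `G₁` and its conjugate by `C` on `G₂` agree on `H`, because `C` is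
    -- invariant under right translation by `H`.
    obtain ⟨Θ, hΘ₁, hΘ₂⟩ := isPushout_exists_lift hΓ (X := Wreath Γ X)
      (SemidirectProduct.inr.comp i₁)
      ((MulAut.conj w).toMonoidHom.comp (SemidirectProduct.inr.comp i₂)) (fun x => by
        have := isPushout_apply_eq hΓ x
        have e : w * SemidirectProduct.inr (i₁ (α x)) = SemidirectProduct.inr (i₁ (α x)) * w := by
          ext y
          · simp [w, hC]
          · simp [w]
        simp [← this, e])
    have hr : ∀ g, (Θ g).right = g := by
      have : SemidirectProduct.rightHom.comp Θ = MonoidHom.id Γ :=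
        isPushout_hom_ext hΓ (fun x => by simp [hΘ₁]) (fun x => by simp [hΘ₂, w])
      exact fun g => DFunLike.congr_fun this g
    have hm := Wreath.left_map_mul Θ hr
    let f₁ : Γ ⧸ i₁.range → X := Quotient.lift (fun g => (Θ g).left 1) fun a b hab => by
      obtain ⟨x, hx⟩ := QuotientGroup.leftRel_apply.1 hab
      have : b = a * i₁ x := by rw [hx, mul_inv_cancel_left]
      simp [this, hΘ₁]
    -- Right multiplication by `i₂ x` multiplies `(Θ g).left 1` by `C g * (C (g * i₂ x))⁻¹`; the
    -- extra factor `C g` makes the function descend and is also the required variation along the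
    -- edge.
    let f₂ : Γ ⧸ i₂.range → X := Quotient.lift (fun g => (Θ g).left 1 * C g) fun a b hab => by
      obtain ⟨x, hx⟩ := QuotientGroup.leftRel_apply.1 hab
      have : b = a * i₂ x := by rw [hx, mul_inv_cancel_left]
      simp only [this, hm, hΘ₂]
      simp [w]
      group
    refine ⟨Sum.elim f₁ f₂, fun e => ?_⟩
    induction e using QuotientGroup.induction_on with
    | H g =>
      simp only [Sum.elim_inl, Sum.elim_inr, cosetMap_mk, mul_one]
      rfl

variable {β : H →* G₁}

/-- The graph on which an HNN extension acts is a tree. -/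
theorem isTree_HNN (hα : Function.Injective α) (hβ : Function.Injective β)
    (h1 : ∀ a ∈ ((HNNExtension.of : G₁ →* HNN α β hα hβ).comp α).range,
      1⁻¹ * a * 1 ∈ (HNNExtension.of : G₁ →* HNN α β hα hβ).range)
    (h2 : ∀ a ∈ ((HNNExtension.of : G₁ →* HNN α β hα hβ).comp α).range,
      (HNNExtension.t⁻¹)⁻¹ * a * HNNExtension.t⁻¹ ∈
        (HNNExtension.of : G₁ →* HNN α β hα hβ).range) :
    IsTree (cosetMap 1 h1) (cosetMap HNNExtension.t⁻¹ h2) where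
  nonempty := ⟨QuotientGroup.mk 1⟩
  connected U hU hne := by
    have key : ∀ x g : HNN α β hα hβ, (QuotientGroup.mk (g * x) ∈ U ↔ QuotientGroup.mk g ∈ U) := by
      intro x
      induction x using HNNExtension.induction_on with
      | of x => exact fun g => iff_of_eq (congrArg (· ∈ U) (QuotientGroup.mk_mul_of_mem g ⟨x, rfl⟩))
      | t =>
        intro g
        have := hU (QuotientGroup.mk (g * HNNExtension.t))
        simpa using this
      | mul x y hx hy => intro g; rw [← mul_assoc, hy, hx]
      | inv x hx => intro g; rw [← hx, inv_mul_cancel_right]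
    have hall : ∀ v, (v ∈ U ↔ QuotientGroup.mk 1 ∈ U) := by
      intro v
      induction v using QuotientGroup.induction_on with
      | H g => simpa using key g 1
    obtain ⟨v, hv⟩ := hne
    ext w
    simp [hall w, (hall v).1 hv]
  coboundary X _ c := by
    let Γ := HNN α β hα hβ
    let τ : Γ := HNNExtension.t
    let C : Γ → X := fun g => c (QuotientGroup.mk g)
    have hC : ∀ g h, C (g * HNNExtension.of (α h)) = C g := fun g h =>
      congrArg c (QuotientGroup.mk_mul_of_mem g ⟨h, rfl⟩)
    -- The edge of `g` runs from the coset of `g` to that of `g * t⁻¹`, so `t⁻¹` is sent to an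
    -- element with function part `C`: crossing the edge then multiplies the potential by `C g`.
    let w : Wreath Γ X := ⟨C, τ⁻¹⟩
    obtain ⟨Θ, hΘ, hΘt⟩ := HNN.exists_lift α β hα hβ (X := Wreath Γ X)
      (SemidirectProduct.inr.comp HNNExtension.of) w⁻¹ (fun h => by
        rw [inv_mul_eq_iff_eq_mul, ← mul_assoc, eq_mul_inv_iff_mul_eq]
        have e := HNN.t_conj α β hα hβ h
        ext y
        · simp [w, hC]
        · simp only [w, MonoidHom.comp_apply, SemidirectProduct.mul_right,
            SemidirectProduct.right_inr]
          rw [eq_inv_mul_iff_mul_eq, ← mul_assoc, e, mul_inv_cancel_right])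
    have hr : ∀ g, (Θ g).right = g := by
      have : SemidirectProduct.rightHom.comp Θ = MonoidHom.id Γ := by
        refine HNNExtension.hom_ext ?_ ?_
        · ext x; simp [hΘ]
        · simp [hΘt, w, τ]; rfl
      exact fun g => DFunLike.congr_fun this g
    have hm := Wreath.left_map_mul Θ hr
    have ht : Θ HNNExtension.t⁻¹ = w := by rw [map_inv, hΘt, inv_inv]
    let f : Γ ⧸ (HNNExtension.of : G₁ →* Γ).range → X :=
      Quotient.lift (fun g => (Θ g).left 1) fun a b hab => by
        obtain ⟨x, hx⟩ := QuotientGroup.leftRel_apply.1 hab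
        have : b = a * HNNExtension.of x := by rw [hx, mul_inv_cancel_left]
        simp [this, hΘ]
    refine ⟨f, fun e => ?_⟩
    induction e using QuotientGroup.induction_on with
    | H g =>
      simp only [cosetMap_mk, mul_one]
      show (Θ (g * HNNExtension.t⁻¹)).left 1 = (Θ g).left 1 * C g
      rw [hm, ht, one_mul]

theorem HNN.conj_mem_range (hα : Function.Injective α) (hβ : Function.Injective β) :
    ∀ a ∈ ((HNNExtension.of : G₁ →* HNN α β hα hβ).comp α).range,
      (HNNExtension.t⁻¹)⁻¹ * a * HNNExtension.t⁻¹ ∈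
        (HNNExtension.of : G₁ →* HNN α β hα hβ).range := by
  rintro _ ⟨h, rfl⟩
  refine ⟨β h, ?_⟩
  rw [inv_inv, MonoidHom.comp_apply, HNN.t_conj, mul_inv_cancel_right]

end BassSerreTrees

/-! ### Stability under preimages, hence under subgroups and extensions -/

section Preimages

/-- If every preimage of a subgroup of `G` is in the class, then so are the stabilizers of the
cosets of `G` in a bigger group. -/
theorem clBar_of_conj_mem_range {G Γ K : Type u} [Group G] [Group Γ] [Group K] (i : G →* Γ)
    (hi : Function.Injective i)
    (ih : ∀ (K : Type u) [Group K] (φ : K →* G), ClBar φ.ker → ClBar K)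
    (φ : K →* Γ) (hφ : ClBar φ.ker) (g : Γ) (S : Subgroup K)
    (hS : ∀ k, k ∈ S ↔ g⁻¹ * φ k * g ∈ i.range) : ClBar S := by
  -- Conjugating by `g` turns `φ` on `S` into a morphism to `G` with the same kernel as `φ`, to
  -- which `ih` applies.
  let c : S →* i.range := MonoidHom.mk' (fun k => ⟨g⁻¹ * φ k * g, (hS k).1 k.2⟩)
    (fun a b => by ext; simp only [Subgroup.coe_mul, map_mul]; group)
  let d : S →* G := (MonoidHom.ofInjective hi).symm.toMonoidHom.comp c
  refine ih S d ?_
  have hker : ∀ k ∈ φ.ker, k ∈ S := fun k hk => (hS k).2 (by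
    rw [MonoidHom.mem_ker.1 hk]; simp)
  refine ClBar.of_injective (Subgroup.inclusion hker) (Subgroup.inclusion_injective _) ?_ hφ
  ext k
  rw [Subgroup.inclusion_range, Subgroup.mem_subgroupOf, MonoidHom.mem_ker, MonoidHom.mem_ker]
  have h1 : d k = 1 ↔ c k = 1 :=
    map_eq_one_iff _ (MonoidHom.ofInjective hi).symm.injective
  rw [h1, Subtype.ext_iff]
  show φ k = 1 ↔ g⁻¹ * φ k * g = 1
  rw [mul_eq_one_iff_eq_inv, inv_mul_eq_iff_eq_mul, mul_inv_cancel]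

theorem clBar_stabilizer_coset {G Γ K : Type u} [Group G] [Group Γ] [Group K] (i : G →* Γ)
    (hi : Function.Injective i)
    (ih : ∀ (K : Type u) [Group K] (φ : K →* G), ClBar φ.ker → ClBar K)
    (φ : K →* Γ) (hφ : ClBar φ.ker) (x : Γ ⧸ i.range) (S : Subgroup K)
    (hS : ∀ k, k ∈ S ↔ φ k • x = x) : ClBar S := by
  induction x using QuotientGroup.induction_on with
  | H g =>
    refine clBar_of_conj_mem_range i hi ih φ hφ g S fun k => ?_
    rw [hS, eq_comm, mul_assoc]
    exact QuotientGroup.eq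

/-- The class is stable under preimages by morphisms whose kernel is in the class. -/
theorem ClBar.of_hom {G : Type u} [Group G] (hG : ClBar G) :
    ∀ (K : Type u) [Group K] (φ : K →* G), ClBar φ.ker → ClBar K := by
  induction hG with
  | trivial G hG =>
    intro K _ φ h
    have : φ.ker = ⊤ := (Subgroup.eq_top_iff' _).2 fun k => Subsingleton.elim _ _
    exact ClBar.of_mulEquiv Subgroup.topEquiv (this ▸ h)
  | @amalgam H G₁ G₂ Γ _ _ _ _ α β i₁ i₂ hα hβ hΓ _ _ _ _ ihH ih₁ ih₂ =>
    intro K _ φ h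
    obtain ⟨hi₁, hi₂⟩ := isPushout_injective hα hβ hΓ
    have h1 : ∀ a ∈ (i₁.comp α).range, (1 : Γ)⁻¹ * a * 1 ∈ i₁.range := by
      rintro _ ⟨a, rfl⟩
      exact ⟨α a, by simp⟩
    have h2 : ∀ a ∈ (i₁.comp α).range, (1 : Γ)⁻¹ * a * 1 ∈ i₂.range := by
      rintro _ ⟨a, rfl⟩
      exact ⟨β a, by simp [isPushout_apply_eq hΓ]⟩
    -- `K` acts on the tree of `Γ` through `φ`; every vertex or edge stabilizer is the preimage of a
    -- conjugate of `G₁`, `G₂` or `H`.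
    let _ : MulAction K (Γ ⧸ (i₁.comp α).range) := MulAction.compHom _ φ
    let _ : MulAction K ((Γ ⧸ i₁.range) ⊕ (Γ ⧸ i₂.range)) := MulAction.compHom _ φ
    refine (isTree_of_isPushout hΓ h1 h2).clBar
      (fun k e => congrArg Sum.inl (cosetMap_smul 1 h1 (φ k) e))
      (fun k e => congrArg Sum.inr (cosetMap_smul 1 h2 (φ k) e)) ?_ ?_
    · rintro (v | v)
      · exact clBar_stabilizer_coset i₁ hi₁ ih₁ φ h v _ fun k => Sum.inl_injective.eq_iff
      · exact clBar_stabilizer_coset i₂ hi₂ ih₂ φ h v _ fun k => Sum.inr_injective.eq_iff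
    · exact fun e => clBar_stabilizer_coset _ (fun _ _ hab => hα (hi₁ hab)) ihH φ h e _ fun k => Iff.rfl
  | @hnn H G Γ _ _ _ α β hα hβ e _ _ _ ihH ihG =>
    suffices ∀ (K : Type u) [Group K] (φ : K →* HNN α β hα hβ), ClBar φ.ker → ClBar K by
      intro K _ φ h
      refine this K (e.symm.toMonoidHom.comp φ) ?_
      have : (e.symm.toMonoidHom.comp φ).ker = φ.ker := by
        ext k; simp [MonoidHom.mem_ker]
      rwa [this]
    intro K _ φ h
    have h1 : ∀ a ∈ ((HNNExtension.of : G →* HNN α β hα hβ).comp α).range,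
        1⁻¹ * a * 1 ∈ (HNNExtension.of : G →* HNN α β hα hβ).range := by
      rintro _ ⟨a, rfl⟩
      exact ⟨α a, by simp⟩
    have h2 := HNN.conj_mem_range hα hβ
    let _ : MulAction K (HNN α β hα hβ ⧸ (HNNExtension.of : G →* HNN α β hα hβ).range) :=
      MulAction.compHom _ φ
    let _ : MulAction K (HNN α β hα hβ ⧸
      ((HNNExtension.of : G →* HNN α β hα hβ).comp α).range) := MulAction.compHom _ φ
    have hi : Function.Injective (HNNExtension.of : G →* HNN α β hα hβ) :=
      HNNExtension.of_injective _
    refine (isTree_HNN hα hβ h1 h2).clBar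
      (fun k e => cosetMap_smul 1 h1 (φ k) e) (fun k e => cosetMap_smul _ h2 (φ k) e) ?_ ?_
    · exact fun v => clBar_stabilizer_coset _ hi ihG φ h v _ fun k => Iff.rfl
    · exact fun e => clBar_stabilizer_coset _ (fun _ _ hab => hα (hi hab)) ihH φ h e _ fun k => Iff.rfl
  | @union G _ ι _ A hdir htop hA ih =>
    intro K _ φ h
    refine GroupClass.union (fun i => (A i).comap φ) (fun i j => ?_) (fun k => htop (φ k))
      (fun i => ?_)
    · obtain ⟨m, h1, h2⟩ := hdir i j
      exact ⟨m, Subgroup.comap_mono h1, Subgroup.comap_mono h2⟩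
    · exact clBar_of_conj_mem_range (A i).subtype Subtype.val_injective (ih i) φ h 1 _
        fun k => by simp

/-- The inclusion of a subgroup has trivial kernel. -/
theorem ClBar.subgroup {G : Type u} [Group G] (hG : ClBar G) (K : Subgroup G) : ClBar K := by
  refine hG.of_hom K K.subtype (GroupClass.trivial _ ?_)
  rw [Subgroup.ker_subtype]
  infer_instance

theorem ClBar.extension {N Γ Q : Type u} [Group N] [Group Γ] [Group Q] (f : N →* Γ) (g : Γ →* Q)
    (hf : Function.Injective f) (h : f.range = g.ker) (hN : ClBar N) (hQ : ClBar Q) : ClBar Γ :=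
  hQ.of_hom Γ g (hN.of_injective f hf h)

theorem GroupClass.mono {P P' : ∀ (H : Type u) [Group H], Prop}
    (h : ∀ (H : Type u) [Group H], P H → P' H) {G : Type u} [Group G] (hG : GroupClass P G) :
    GroupClass P' G := by
  induction hG with
  | trivial G hG => exact .trivial G hG
  | amalgam α β i₁ i₂ hα hβ hΓ hP _ _ _ ihH ih₁ ih₂ =>
    exact .amalgam α β i₁ i₂ hα hβ hΓ (h _ hP) ihH ih₁ ih₂
  | hnn α β hα hβ e hP _ _ ihH ihG => exact .hnn α β hα hβ e (h _ hP) ihH ihG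
  | union K hdir htop _ ih => exact .union K hdir htop ih

end Preimages

/-! ### Exact cocomplete classes and transfer of regularity -/

section RegularRings

variable {A B : Type u} [Ring A] [Ring B]

theorem IsExactClass.middle_mem {C : ObjectProperty (ModuleCat.{u} A)} (hC : IsExactClass A C)
    {X Y Z : ModuleCat.{u} A} (f : X →ₗ[A] Y) (g : Y →ₗ[A] Z) (hf : Function.Injective f)
    (hfg : Function.Exact f g) (hg : Function.Surjective g) (hX : C X) (hZ : C Z) : C Y :=
  hC.middle (ShortComplex.mk (ModuleCat.ofHom f) (ModuleCat.ofHom g)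
    (ModuleCat.hom_ext hfg.linearMap_comp_eq_zero))
    (ModuleCat.shortComplex_shortExact _ hfg hf hg) hX hZ

theorem IsExactClass.right_mem {C : ObjectProperty (ModuleCat.{u} A)} (hC : IsExactClass A C)
    {X Y Z : ModuleCat.{u} A} (f : X →ₗ[A] Y) (g : Y →ₗ[A] Z) (hf : Function.Injective f)
    (hfg : Function.Exact f g) (hg : Function.Surjective g) (hX : C X) (hY : C Y) : C Z :=
  hC.right (ShortComplex.mk (ModuleCat.ofHom f) (ModuleCat.ofHom g)
    (ModuleCat.hom_ext hfg.linearMap_comp_eq_zero))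
    (ModuleCat.shortComplex_shortExact _ hfg hf hg) hX hY

/-- Isomorphism invariance is not assumed of a class; it follows from the exact sequence `0 → M → N
→ 0 → 0`, the zero module being finitely generated projective. -/
theorem IsExactClass.mem_of_linearEquiv {C : ObjectProperty (ModuleCat.{u} A)}
    (hC : IsExactClass A C)
    (hP : ∀ P : ModuleCat.{u} A, Module.Finite A P → Module.Projective A P → C P)
    {M N : ModuleCat.{u} A} (e : M ≃ₗ[A] N) (hM : C M) : C N := by
  refine hC.middle_mem (Z := ModuleCat.of A PUnit) e.toLinearMap 0 e.injective ?_
    (fun _ => ⟨0, rfl⟩) hM (hP _ inferInstance inferInstance)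
  exact fun y => ⟨fun _ => e.surjective y, fun _ => rfl⟩

theorem IsCocompleteClass.directLimit_mem {C : ObjectProperty (ModuleCat.{u} A)}
    (hC : IsCocompleteClass A C) {ι : Type u} [DecidableEq ι] [Preorder ι] [IsDirectedOrder ι]
    [Nonempty ι] (X : ι → Type u) [∀ i, AddCommGroup (X i)] [∀ i, Module A (X i)]
    (f : ∀ i j, i ≤ j → X i →ₗ[A] X j) [DirectedSystem X fun i j h => f i j h]
    (h : ∀ i, C (ModuleCat.of A (X i))) : C (ModuleCat.of A (Module.DirectLimit X f)) := by
  have := hC ι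
  exact C.prop_of_isColimit (ModuleCat.directLimitIsColimit X f) h

/-- An exact functor which commutes with filtered colimits and preserves finitely generated
projective modules sends the modules over a regular ring into any exact cocomplete class containing
the finitely generated projective modules. -/
theorem LeftRegular.obj_mem (hA : LeftRegular A) (F : ModuleCat.{u} A ⥤ ModuleCat.{u} B)
    [F.PreservesZeroMorphisms]
    (hcolim : ∀ (J : Type u) [SmallCategory J] [IsFiltered J], Limits.PreservesColimitsOfShape J F)
    (hex : ∀ S : ShortComplex (ModuleCat.{u} A), S.ShortExact → (S.map F).ShortExact)
    (hproj : ∀ P : ModuleCat.{u} A, Module.Finite A P → Module.Projective A P →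
      Module.Finite B (F.obj P) ∧ Module.Projective B (F.obj P))
    {C : ObjectProperty (ModuleCat.{u} B)} (hC : IsExactClass B C) (hC' : IsCocompleteClass B C)
    (hP : ∀ P : ModuleCat.{u} B, Module.Finite B P → Module.Projective B P → C P)
    (M : ModuleCat.{u} A) : C (F.obj M) := by
  refine hA (C.inverseImage F) ⟨?_, ?_, ?_⟩ ?_ ?_ M
  · exact fun S hS h1 h2 => hC.left _ (hex S hS) h1 h2
  · exact fun S hS h1 h2 => hC.middle _ (hex S hS) h1 h2
  · exact fun S hS h1 h2 => hC.right _ (hex S hS) h1 h2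
  · intro J _ _
    have := hcolim J
    have := hC' J
    infer_instance
  · exact fun P h1 h2 => hP _ (hproj P h1 h2).1 (hproj P h1 h2).2

theorem LeftRegular.of_ringEquiv (e : A ≃+* B) (hA : LeftRegular A) : LeftRegular B := by
  intro C hC hC' hP M
  let F := ModuleCat.restrictScalars.{u} e.symm.toRingHom
  have : F.IsEquivalence := ModuleCat.restrictScalars_isEquivalence_of_ringEquiv e.symm
  let N := (ModuleCat.restrictScalars.{u} e.toRingHom).obj M
  have hF : C (F.obj N) := by
    refine hA.obj_mem F (fun J _ _ => inferInstance)
      (fun S hS => hS.map_of_exact F) (fun P h1 h2 => ?_) hC hC' hP _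
    have : RingHomInvPair e.toRingHom e.symm.toRingHom := .of_ringEquiv e
    have : RingHomInvPair e.symm.toRingHom e.toRingHom := .of_ringEquiv e.symm
    let ε : P ≃ₛₗ[e.toRingHom] F.obj P :=
      { AddEquiv.refl P with
        map_smul' := fun r x => by
          show r • x = e.symm (e r) • x
          rw [e.symm_apply_apply] }
    exact ⟨Module.Finite.of_surjective ε.toLinearMap ε.surjective, Module.Projective.of_equiv ε⟩
  refine hC.mem_of_linearEquiv hP (M := F.obj N) (N := M) ?_ hF
  exact
    { AddEquiv.refl M with
      map_smul' := fun r x => by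
        show e (e.symm r) • (show M from x) = r • (show M from x)
        rw [e.apply_symm_apply] }

/-- A principal ideal domain is regular. -/
theorem leftRegular_of_isPrincipalIdealRing (R : Type u) [CommRing R] [IsDomain R]
    [IsPrincipalIdealRing R] : LeftRegular R := by
  classical
  intro C hC hC' hP M
  -- Over a principal ideal domain the kernel of `R ^ n → N` is finitely generated projective. A
  -- general module is then the filtered colimit of its finitely generated submodules.
  have hfg : ∀ N : ModuleCat.{u} R, Module.Finite R N → C N := by
    intro N hN
    obtain ⟨n, f, hf⟩ := Module.Finite.exists_fin' R N
    exact hC.right_mem (X := ModuleCat.of R (LinearMap.ker f)) (Y := ModuleCat.of R (Fin n → R))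
      (LinearMap.ker f).subtype f (LinearMap.ker f).injective_subtype
      (LinearMap.exact_subtype_ker_map f) hf (hP _ inferInstance inferInstance)
      (hP _ inferInstance inferInstance)
  have hdir : IsDirectedOrder {N : Submodule R M // N.FG} :=
    ⟨fun a b => ⟨⟨a.1 ⊔ b.1, a.2.sup b.2⟩, le_sup_left (a := a.1), le_sup_right (b := b.1)⟩⟩
  have : Nonempty {N : Submodule R M // N.FG} := ⟨⟨⊥, Submodule.fg_bot⟩⟩
  have hlim := hC'.directLimit_mem (fun N : {N : Submodule R M // N.FG} => N.1)
    (Module.fgSystem R M) (fun N => hfg (ModuleCat.of R N.1) (Module.Finite.iff_fg.2 N.2))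
  exact hC.mem_of_linearEquiv hP (Module.fgSystem.equiv R M) hlim

end RegularRings

/-! ### Modules twisted by a cocycle, covering both induced and diagonal modules -/

section TwistedModules

variable {G H X : Type u} [Group G] [Group H] [MulAction G X]

/-- A cocycle on a `G`-set with values in a group `H`. -/
structure Cocycle (G X H : Type u) [Group G] [Group H] [MulAction G X] where
  /-- The underlying function. -/
  toFun : G → X → H
  map_mul : ∀ g g' x, toFun (g * g') x = toFun g (g' • x) * toFun g' x

theorem Cocycle.map_one (κ : Cocycle G X H) (x : X) : κ.toFun 1 x = 1 := by
  have := κ.map_mul 1 1 x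
  rw [one_smul, one_mul] at this
  exact mul_eq_left.1 this.symm

/-- The element of the integral group ring given by an element of the group. -/
noncomputable def grp : G →* MonoidAlgebra ℤ G := MonoidAlgebra.of ℤ G

/-- An additive map compatible with the group action is linear over the group ring. -/
def linearMapOfGrp {M N : Type*} [AddCommGroup M] [AddCommGroup N] [Module (MonoidAlgebra ℤ G) M]
    [Module (MonoidAlgebra ℤ G) N] (f : M →+ N) (hf : ∀ (g : G) m, f (grp g • m) = grp g • f m) :
    M →ₗ[MonoidAlgebra ℤ G] N :=
  { f with
    map_smul' := fun r m => by
      show f (r • m) = r • f m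
      induction r using MonoidAlgebra.induction_on generalizing m with
      | of g => exact hf g m
      | add x y hx hy => rw [add_smul, map_add, hx, hy, add_smul]
      | smul n x hx =>
        rw [smul_assoc, map_zsmul, hx, smul_assoc] }

/-- The finitely supported functions on a `G`-set with values in an `H`-module, on which `G` acts
through a cocycle. -/
def Twisted (_κ : Cocycle G X H) (N : Type u) [AddCommGroup N] : Type u := X →₀ N

variable (κ : Cocycle G X H) (N : Type u) [AddCommGroup N]

noncomputable instance : AddCommGroup (Twisted κ N) := inferInstanceAs (AddCommGroup (X →₀ N))

variable {κ N} in
/-- The underlying finitely supported function. -/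
noncomputable def Twisted.toFinsupp : Twisted κ N ≃+ (X →₀ N) := AddEquiv.refl _

/-- The function with one value. -/
noncomputable def Twisted.single (x : X) : N →+ Twisted κ N := Finsupp.singleAddHom x

variable {N} in
/-- The additive map with given values on the functions supported by one element. -/
noncomputable def Twisted.lift {M : Type*} [AddCommGroup M] (f : X → N →+ M) : Twisted κ N →+ M :=
  Finsupp.liftAddHom f

variable {κ N}

@[simp]
theorem Twisted.lift_single {M : Type*} [AddCommGroup M] (f : X → N →+ M) (x : X) (n : N) :
    Twisted.lift κ f (Twisted.single κ N x n) = f x n :=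
  Finsupp.liftAddHom_apply_single f x n

theorem Twisted.addHom_ext {M : Type*} [AddCommGroup M] {f g : Twisted κ N →+ M}
    (h : ∀ x n, f (Twisted.single κ N x n) = g (Twisted.single κ N x n)) : f = g :=
  Finsupp.addHom_ext h

variable [Module (MonoidAlgebra ℤ H) N]

variable (κ N) in
/-- The action of `G` on the twisted functions. -/
noncomputable def Twisted.action : G →* AddMonoid.End (Twisted κ N) where
  toFun g := Twisted.lift κ fun x =>
    (Twisted.single κ N (g • x)).comp (DistribSMul.toAddMonoidHom N (grp (κ.toFun g x)))
  map_one' := Twisted.addHom_ext fun x n => by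
    show _ = Twisted.single κ N x n
    simp [κ.map_one]
  map_mul' g g' := Twisted.addHom_ext fun x n => by
    show _ = Twisted.lift κ _ (Twisted.lift κ _ (Twisted.single κ N x n))
    simp [κ.map_mul, mul_smul]

noncomputable instance : Module (MonoidAlgebra ℤ G) (Twisted κ N) :=
  Module.compHom _ (MonoidAlgebra.lift ℤ (AddMonoid.End (Twisted κ N)) G
    (Twisted.action κ N)).toRingHom

@[simp]
theorem Twisted.grp_smul_single (g : G) (x : X) (n : N) :
    grp g • Twisted.single κ N x n = Twisted.single κ N (g • x) (grp (κ.toFun g x) • n) := by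
  show MonoidAlgebra.lift ℤ (AddMonoid.End (Twisted κ N)) G (Twisted.action κ N) (grp g) _ = _
  rw [grp, MonoidAlgebra.lift_of]
  exact Twisted.lift_single _ _ _

/-- An additive map on the twisted functions compatible with the group action on generators is
linear over the group ring. -/
noncomputable def Twisted.linearLift {M : Type*} [AddCommGroup M] [Module (MonoidAlgebra ℤ G) M]
    (f : X → N →+ M)
    (hf : ∀ g x n, f (g • x) (grp (κ.toFun g x) • n) = grp g • f x n) :
    Twisted κ N →ₗ[MonoidAlgebra ℤ G] M :=
  linearMapOfGrp (Twisted.lift κ f) fun g m => by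
    have : (Twisted.lift κ f).comp (DistribSMul.toAddMonoidHom _ (grp g)) =
        (DistribSMul.toAddMonoidHom M (grp g)).comp (Twisted.lift κ f) :=
      Twisted.addHom_ext fun x n => by simp [hf]
    exact DFunLike.congr_fun this m

@[simp]
theorem Twisted.linearLift_single {M : Type*} [AddCommGroup M] [Module (MonoidAlgebra ℤ G) M]
    (f : X → N →+ M) (hf : ∀ g x n, f (g • x) (grp (κ.toFun g x) • n) = grp g • f x n)
    (x : X) (n : N) : Twisted.linearLift (κ := κ) f hf (Twisted.single κ N x n) = f x n :=
  Twisted.lift_single f x n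

theorem Twisted.linearMap_ext {M : Type*} [AddCommGroup M] [Module (MonoidAlgebra ℤ G) M]
    {f g : Twisted κ N →ₗ[MonoidAlgebra ℤ G] M}
    (h : ∀ x n, f (Twisted.single κ N x n) = g (Twisted.single κ N x n)) : f = g :=
  LinearMap.toAddMonoidHom_injective (Twisted.addHom_ext h)

variable {N' N'' : Type u} [AddCommGroup N'] [Module (MonoidAlgebra ℤ H) N'] [AddCommGroup N'']
  [Module (MonoidAlgebra ℤ H) N'']

variable (κ) in
/-- The functoriality of the twisted functions. -/
noncomputable def Twisted.map (f : N →ₗ[MonoidAlgebra ℤ H] N') :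
    Twisted κ N →ₗ[MonoidAlgebra ℤ G] Twisted κ N' :=
  Twisted.linearLift (fun x => (Twisted.single κ N' x).comp f.toAddMonoidHom) fun g x n => by
    simp

@[simp]
theorem Twisted.map_single (f : N →ₗ[MonoidAlgebra ℤ H] N') (x : X) (n : N) :
    Twisted.map κ f (Twisted.single κ N x n) = Twisted.single κ N' x (f n) := by
  simp [Twisted.map]

/-- The cocycle affects only the action, so exactness of the functor can be checked pointwise on
finitely supported functions. -/
theorem Twisted.toFinsupp_map (f : N →ₗ[MonoidAlgebra ℤ H] N') (v : Twisted κ N) :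
    Twisted.toFinsupp (Twisted.map κ f v) =
      Finsupp.mapRange f f.map_zero (Twisted.toFinsupp v) := by
  have : Twisted.toFinsupp.toAddMonoidHom.comp (Twisted.map κ f).toAddMonoidHom =
      (Finsupp.mapRange.addMonoidHom f.toAddMonoidHom).comp Twisted.toFinsupp.toAddMonoidHom :=
    Twisted.addHom_ext fun x n => (Twisted.map_single f x n).trans
      (Finsupp.mapRange_single (hf := f.map_zero)).symm
  exact DFunLike.congr_fun this v

theorem Twisted.map_injective {f : N →ₗ[MonoidAlgebra ℤ H] N'} (hf : Function.Injective f) :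
    Function.Injective (Twisted.map κ f) := by
  intro v w h
  have h' := congrArg Twisted.toFinsupp h
  rw [Twisted.toFinsupp_map, Twisted.toFinsupp_map] at h'
  exact Twisted.toFinsupp.injective (Finsupp.mapRange_injective f f.map_zero hf h')

theorem Twisted.map_surjective {f : N →ₗ[MonoidAlgebra ℤ H] N'} (hf : Function.Surjective f) :
    Function.Surjective (Twisted.map κ f) := by
  intro w
  obtain ⟨v, hv⟩ := Finsupp.mapRange_surjective f f.map_zero hf (Twisted.toFinsupp w)
  refine ⟨Twisted.toFinsupp.symm v, Twisted.toFinsupp.injective ?_⟩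
  rw [Twisted.toFinsupp_map, AddEquiv.apply_symm_apply, hv]

theorem Twisted.map_exact {f : N →ₗ[MonoidAlgebra ℤ H] N'} {g : N' →ₗ[MonoidAlgebra ℤ H] N''}
    (hfg : Function.Exact f g) : Function.Exact (Twisted.map κ f) (Twisted.map κ g) := by
  have h0 : (Twisted.map κ g).comp (Twisted.map κ f) = 0 :=
    Twisted.linearMap_ext fun x n => by simp [hfg.apply_apply_eq_zero]
  intro v
  refine ⟨fun hv => ?_, ?_⟩
  · have hv1 := congrArg Twisted.toFinsupp hv
    rw [Twisted.toFinsupp_map, map_zero] at hv1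
    have hv' : ∀ x, ∃ n, f n = Twisted.toFinsupp v x := fun x =>
      (hfg _).1 (by simpa using DFunLike.congr_fun hv1 x)
    choose s hs using hv'
    classical
    -- The chosen preimage of `0` may be nonzero; replacing it by `0` off the support keeps the lift
    -- finitely supported.
    let w : X →₀ N := Finsupp.onFinset (Twisted.toFinsupp v).support
      (fun x => if Twisted.toFinsupp v x = 0 then 0 else s x) (fun x hx => by
        rw [Finsupp.mem_support_iff]
        intro h
        simp [h] at hx)
    refine ⟨Twisted.toFinsupp.symm w, Twisted.toFinsupp.injective ?_⟩
    rw [Twisted.toFinsupp_map, AddEquiv.apply_symm_apply]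
    ext x
    rw [Finsupp.mapRange_apply]
    by_cases h : Twisted.toFinsupp v x = 0
    · simp [w, h]
    · simp [w, h, hs]
  · rintro ⟨w, rfl⟩
    exact LinearMap.congr_fun h0 w

variable (κ) in
/-- The twisted functions, as a functor. -/
noncomputable def twistedFunctor :
    ModuleCat.{u} (MonoidAlgebra ℤ H) ⥤ ModuleCat.{u} (MonoidAlgebra ℤ G) where
  obj N := ModuleCat.of _ (Twisted κ N)
  map f := ModuleCat.ofHom (Twisted.map κ f.hom)
  map_id N := ModuleCat.hom_ext (Twisted.linearMap_ext fun x n => by simp)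
  map_comp f g := ModuleCat.hom_ext (Twisted.linearMap_ext fun x n => by simp)

instance : (twistedFunctor κ).PreservesZeroMorphisms where
  map_zero _ _ := ModuleCat.hom_ext (Twisted.linearMap_ext fun x n =>
    (Twisted.map_single _ x n).trans (map_zero _))

theorem twistedFunctor_map_shortExact (S : ShortComplex (ModuleCat.{u} (MonoidAlgebra ℤ H)))
    (hS : S.ShortExact) : (S.map (twistedFunctor κ)).ShortExact :=
  ModuleCat.shortComplex_shortExact _
    (Twisted.map_exact ((ShortComplex.ShortExact.moduleCat_exact_iff_function_exact _).1 hS.exact))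
    (Twisted.map_injective hS.moduleCat_injective_f)
    (Twisted.map_surjective hS.moduleCat_surjective_g)

end TwistedModules

/-! ### Induction from a subgroup and its adjunction with restriction -/

section Induction

variable {G H : Type u} [Group G] [Group H] (i : H →* G) (hi : Function.Injective i)

/-- The cocycle on the cosets of a subgroup defined by a choice of representatives. -/
noncomputable def cosetCocycle : Cocycle G (G ⧸ i.range) H where
  toFun g x := (MonoidHom.ofInjective hi).symm ⟨(g • x).out⁻¹ * (g * x.out), by
    rw [← QuotientGroup.eq, QuotientGroup.out_eq']
    conv_lhs => rw [← QuotientGroup.out_eq' x]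
    rfl⟩
  map_mul g g' x := by
    rw [← map_mul]
    congr 1
    ext
    simp only [Subgroup.coe_mul, mul_smul]
    group

theorem apply_cosetCocycle (g : G) (x : G ⧸ i.range) :
    i ((cosetCocycle i hi).toFun g x) = (g • x).out⁻¹ * (g * x.out) :=
  MonoidHom.apply_ofInjective_symm hi _

theorem cosetCocycle_eq {g : G} {x : G ⧸ i.range} {h : H}
    (hh : (g • x).out * i h = g * x.out) : (cosetCocycle i hi).toFun g x = h :=
  hi (by rw [apply_cosetCocycle, ← hh, inv_mul_cancel_left])

/-- The induction of modules along an injective morphism of groups. -/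
noncomputable abbrev indFunctor :
    ModuleCat.{u} (MonoidAlgebra ℤ H) ⥤ ModuleCat.{u} (MonoidAlgebra ℤ G) :=
  twistedFunctor (cosetCocycle i hi)

/-- The restriction of modules along a morphism of groups. -/
noncomputable abbrev resFunctor :
    ModuleCat.{u} (MonoidAlgebra ℤ G) ⥤ ModuleCat.{u} (MonoidAlgebra ℤ H) :=
  ModuleCat.restrictScalars (MonoidAlgebra.mapDomainRingHom ℤ i)

/-- An additive map compatible with the group actions is semilinear over the group rings. -/
def semilinearMapOfGrp {N M : Type*} [AddCommGroup N] [AddCommGroup M]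
    [Module (MonoidAlgebra ℤ H) N] [Module (MonoidAlgebra ℤ G) M] (φ : N →+ M)
    (hφ : ∀ (h : H) n, φ (grp h • n) = grp (i h) • φ n) :
    N →ₛₗ[MonoidAlgebra.mapDomainRingHom ℤ i] M :=
  { φ with
    map_smul' := fun r n => by
      show φ (r • n) = MonoidAlgebra.mapDomainRingHom ℤ i r • φ n
      induction r using MonoidAlgebra.induction_on generalizing n with
      | of h =>
        refine (hφ h n).trans ?_
        congr 1
        simp [grp]
      | add x y hx hy => rw [add_smul, map_add, hx, hy, map_add, add_smul]
      | smul k x hx => rw [smul_assoc, map_zsmul, hx, map_zsmul, smul_assoc] }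

theorem semilinearMap_grp_smul {N M : Type*} [AddCommGroup N] [AddCommGroup M]
    [Module (MonoidAlgebra ℤ H) N] [Module (MonoidAlgebra ℤ G) M]
    (φ : N →ₛₗ[MonoidAlgebra.mapDomainRingHom ℤ i] M) (h : H) (n : N) :
    φ (grp h • n) = grp (i h) • φ n := by
  rw [map_smulₛₗ]
  congr 1
  simp [grp]

theorem exists_apply_eq_out_one : ∃ a : H, i a = (QuotientGroup.mk 1 : G ⧸ i.range).out := by
  show _ ∈ i.range
  have : (QuotientGroup.mk 1 : G ⧸ i.range) = (QuotientGroup.mk 1 : G ⧸ i.range).out :=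
    (QuotientGroup.out_eq' _).symm
  rw [QuotientGroup.eq, inv_one, one_mul] at this
  exact this

/-- The element of `H` giving the representative of the trivial coset. -/
noncomputable def outOne : H := (exists_apply_eq_out_one i).choose

theorem apply_outOne : i (outOne i) = (QuotientGroup.mk 1 : G ⧸ i.range).out :=
  (exists_apply_eq_out_one i).choose_spec

/-- The unit of the adjunction between induction and restriction. -/
noncomputable def indUnit (N : Type u) [AddCommGroup N] [Module (MonoidAlgebra ℤ H) N] :
    N →+ Twisted (cosetCocycle i hi) N :=
  -- The chosen representative of the trivial coset is `i (outOne i)`, not necessarily `1`; acting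
  -- by `(outOne i)⁻¹` compensates for it and makes the unit equivariant.
  (Twisted.single _ N (QuotientGroup.mk 1)).comp
    (DistribSMul.toAddMonoidHom N (grp (outOne i)⁻¹))

variable (N : Type u) [AddCommGroup N] [Module (MonoidAlgebra ℤ H) N]

theorem indUnit_apply (n : N) : indUnit i hi N n =
    Twisted.single _ N (QuotientGroup.mk 1) (grp (outOne i)⁻¹ • n) := rfl

theorem grp_smul_indUnit (h : H) (n : N) :
    grp (i h) • indUnit i hi N n = indUnit i hi N (grp h • n) := by
  have hx : i h • (QuotientGroup.mk 1 : G ⧸ i.range) = QuotientGroup.mk 1 := by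
    have : (QuotientGroup.mk (1 * i h) : G ⧸ i.range) = QuotientGroup.mk 1 :=
      QuotientGroup.mk_mul_of_mem 1 ⟨h, rfl⟩
    rw [one_mul] at this
    exact (congrArg QuotientGroup.mk (mul_one (i h))).trans this
  have hκ : (cosetCocycle i hi).toFun (i h) (QuotientGroup.mk 1) =
      (outOne i)⁻¹ * h * outOne i := by
    apply cosetCocycle_eq
    rw [hx, ← apply_outOne, map_mul, map_mul, map_inv]
    group
  simp only [indUnit_apply, Twisted.grp_smul_single, hx, hκ, ← mul_smul, ← map_mul,
    mul_inv_cancel_right]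

/-- Translates of the image of the unit give all functions supported at one coset, so a linear map
on an induced module is determined by its restriction along the unit. -/
theorem grp_out_smul_indUnit (x : G ⧸ i.range) (n : N) :
    grp x.out • indUnit i hi N n = Twisted.single (cosetCocycle i hi) N x n := by
  have hx : x.out • (QuotientGroup.mk 1 : G ⧸ i.range) = x := by
    conv_rhs => rw [← QuotientGroup.out_eq' x]
    exact congrArg QuotientGroup.mk (mul_one _)
  have hκ : (cosetCocycle i hi).toFun x.out (QuotientGroup.mk 1) = outOne i := by
    apply cosetCocycle_eq
    rw [hx, apply_outOne]
  rw [indUnit_apply, Twisted.grp_smul_single, hx, hκ, ← mul_smul, ← map_mul, mul_inv_cancel,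
    map_one, one_smul]

variable {N} in
theorem ind_hom_ext {M : Type*} [AddCommGroup M] [Module (MonoidAlgebra ℤ G) M]
    {f g : Twisted (cosetCocycle i hi) N →ₗ[MonoidAlgebra ℤ G] M}
    (h : ∀ n, f (indUnit i hi N n) = g (indUnit i hi N n)) : f = g :=
  Twisted.linearMap_ext fun x n => by
    rw [← grp_out_smul_indUnit, map_smul, map_smul, h]

variable {N} in
/-- The linear map on an induced module given by a semilinear map. -/
noncomputable def indDesc {M : Type u} [AddCommGroup M] [Module (MonoidAlgebra ℤ G) M]
    (φ : N →ₛₗ[MonoidAlgebra.mapDomainRingHom ℤ i] M) :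
    Twisted (cosetCocycle i hi) N →ₗ[MonoidAlgebra ℤ G] M :=
  Twisted.linearLift
    (fun x => (DistribSMul.toAddMonoidHom M (grp x.out)).comp φ.toAddMonoidHom) fun g x n => by
      show grp (g • x).out • φ (grp _ • n) = grp g • grp x.out • φ n
      rw [semilinearMap_grp_smul, ← mul_smul, ← mul_smul, ← map_mul, ← map_mul,
        apply_cosetCocycle, mul_inv_cancel_left]

variable {N} in
theorem indDesc_indUnit {M : Type u} [AddCommGroup M] [Module (MonoidAlgebra ℤ G) M]
    (φ : N →ₛₗ[MonoidAlgebra.mapDomainRingHom ℤ i] M) (n : N) :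
    indDesc i hi φ (indUnit i hi N n) = φ n := by
  refine (Twisted.linearLift_single _ _ _ _).trans ?_
  show grp (QuotientGroup.mk 1 : G ⧸ i.range).out • φ (grp (outOne i)⁻¹ • n) = φ n
  rw [semilinearMap_grp_smul, ← apply_outOne, ← mul_smul, ← map_mul grp, ← map_mul,
    mul_inv_cancel, map_one, map_one, one_smul]

theorem map_indUnit {N' : Type u} [AddCommGroup N'] [Module (MonoidAlgebra ℤ H) N']
    (f : N →ₗ[MonoidAlgebra ℤ H] N') (n : N) :
    Twisted.map (cosetCocycle i hi) f (indUnit i hi N n) = indUnit i hi N' (f n) := by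
  rw [indUnit_apply, Twisted.map_single, map_smul, ← indUnit_apply]

/-- The universal property of induced modules. -/
noncomputable def indEquiv (M : Type u) [AddCommGroup M] [Module (MonoidAlgebra ℤ G) M] :
    (Twisted (cosetCocycle i hi) N →ₗ[MonoidAlgebra ℤ G] M) ≃
      (N →ₛₗ[MonoidAlgebra.mapDomainRingHom ℤ i] M) where
  toFun f := semilinearMapOfGrp i (f.toAddMonoidHom.comp (indUnit i hi N)) fun h n => by
    show f (indUnit i hi N (grp h • n)) = grp (i h) • f (indUnit i hi N n)
    rw [← grp_smul_indUnit, map_smul]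
  invFun := indDesc i hi
  left_inv _ := ind_hom_ext i hi fun n => indDesc_indUnit i hi _ n
  right_inv φ := LinearMap.ext fun n => indDesc_indUnit i hi φ n

/-- Induction is left adjoint to restriction. -/
noncomputable def indResAdjunction : indFunctor i hi ⊣ resFunctor i :=
  Adjunction.mkOfHomEquiv
    { homEquiv := fun N M => (ModuleCat.homEquiv.trans (indEquiv i hi N M)).trans
        (ModuleCat.semilinearMapAddEquiv _ N M).toEquiv
      homEquiv_naturality_left_symm := fun f g => ModuleCat.hom_ext
        (ind_hom_ext i hi fun n => by
          refine (indDesc_indUnit i hi _ n).trans (Eq.symm ?_)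
          refine (congrArg (indDesc i hi ((ModuleCat.semilinearMapAddEquiv
            (MonoidAlgebra.mapDomainRingHom ℤ i) _ _).symm g)) (map_indUnit i hi _ f.hom n)).trans ?_
          exact indDesc_indUnit i hi _ (f.hom n))
      homEquiv_naturality_right := fun f g => rfl }

/-- The unit carries generators to generators: modulo their span the unit vanishes, so the quotient
map is zero by `ind_hom_ext`. -/
theorem ind_finite (h : Module.Finite (MonoidAlgebra ℤ H) N) :
    Module.Finite (MonoidAlgebra ℤ G) (Twisted (cosetCocycle i hi) N) := by
  classical
  obtain ⟨S, hS⟩ := h.fg_top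
  refine ⟨⟨S.image (indUnit i hi N), ?_⟩⟩
  let W := Submodule.span (MonoidAlgebra ℤ G)
    (S.image (indUnit i hi N) : Set (Twisted (cosetCocycle i hi) N))
  have key : ∀ n : N, indUnit i hi N n ∈ W := by
    intro n
    have hn : n ∈ Submodule.span (MonoidAlgebra ℤ H) (S : Set N) := hS ▸ Submodule.mem_top
    induction hn using Submodule.span_induction with
    | mem n hn => exact Submodule.subset_span (Finset.mem_coe.2 (Finset.mem_image_of_mem _ hn))
    | zero => rw [map_zero]; exact W.zero_mem
    | add a b _ _ ha hb => rw [map_add]; exact W.add_mem ha hb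
    | smul r n _ hn =>
      induction r using MonoidAlgebra.induction_on with
      | of h =>
        have := W.smul_mem (grp (i h)) hn
        rwa [grp_smul_indUnit] at this
      | add a b ha hb => rw [add_smul, map_add]; exact W.add_mem ha hb
      | smul k a ha => rw [smul_assoc, map_zsmul]; exact W.toAddSubgroup.zsmul_mem ha k
  have hq : W.mkQ = 0 := ind_hom_ext i hi fun n => (Submodule.Quotient.mk_eq_zero W).2 (key n)
  show W = ⊤
  rw [← Submodule.ker_mkQ W, hq, LinearMap.ker_zero]

/-- A left adjoint preserves projectives as soon as its right adjoint preserves epimorphisms, which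
restriction does. -/
theorem ind_projective (h : Module.Projective (MonoidAlgebra ℤ H) N) :
    Module.Projective (MonoidAlgebra ℤ G) (Twisted (cosetCocycle i hi) N) := by
  have hep : (resFunctor i).PreservesEpimorphisms := ⟨fun f hf => by
    rw [ModuleCat.epi_iff_surjective] at hf ⊢
    exact hf⟩
  have := (indResAdjunction i hi).map_projective (ModuleCat.of _ N)
    ((IsProjective.iff_projective (R := MonoidAlgebra ℤ H) N).1 h)
  exact (IsProjective.iff_projective (R := MonoidAlgebra ℤ G) _).2 this

/-- Modules induced from a subgroup with a regular group ring belong to every exact cocomplete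
class containing the finitely generated projective modules. -/
theorem ind_mem (hH : LeftRegular (MonoidAlgebra ℤ H))
    {C : ObjectProperty (ModuleCat.{u} (MonoidAlgebra ℤ G))}
    (hC : IsExactClass (MonoidAlgebra ℤ G) C) (hC' : IsCocompleteClass (MonoidAlgebra ℤ G) C)
    (hP : ∀ P : ModuleCat.{u} (MonoidAlgebra ℤ G), Module.Finite (MonoidAlgebra ℤ G) P →
      Module.Projective (MonoidAlgebra ℤ G) P → C P)
    (N : ModuleCat.{u} (MonoidAlgebra ℤ H)) :
    C (ModuleCat.of _ (Twisted (cosetCocycle i hi) N)) := by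
  have : (indFunctor i hi).IsLeftAdjoint := (indResAdjunction i hi).isLeftAdjoint
  exact hH.obj_mem (indFunctor i hi) (fun J _ _ => inferInstance)
    (fun S hS => twistedFunctor_map_shortExact S hS)
    (fun P h1 h2 => ⟨ind_finite i hi P h1, ind_projective i hi P h2⟩) hC hC' hP N

end Induction

/-! ### Diagonal modules and the exact sequence of a tree -/

section DiagonalModules

variable {G : Type u} [Group G]

/-- The cocycle defining the diagonal action on the functions on a `G`-set with values in a
`G`-module. -/
def diagCocycle (G X : Type u) [Group G] [MulAction G X] : Cocycle G X G where
  toFun g _ := g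
  map_mul _ _ _ := rfl

@[simp]
theorem diagCocycle_toFun {X : Type u} [MulAction G X] (g : G) (x : X) :
    (diagCocycle G X).toFun g x = g := rfl

/-- The finitely supported functions on a `G`-set with values in a `G`-module, with the diagonal
action of `G`. -/
abbrev Diag (G X M : Type u) [Group G] [MulAction G X] [AddCommGroup M] : Type u :=
  Twisted (diagCocycle G X) M

variable {V E X Y : Type u} [MulAction G V] [MulAction G E] [MulAction G X] [MulAction G Y]
  (M : Type u) [AddCommGroup M] [Module (MonoidAlgebra ℤ G) M]

/-- The map of diagonal modules induced by an equivariant map. -/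
noncomputable def Diag.map (f : X → Y) (hf : ∀ (g : G) x, f (g • x) = g • f x) :
    Diag G X M →ₗ[MonoidAlgebra ℤ G] Diag G Y M :=
  Twisted.linearLift (fun x => Twisted.single _ M (f x)) fun g x n => by simp [hf]

@[simp]
theorem Diag.map_single (f : X → Y) (hf : ∀ (g : G) x, f (g • x) = g • f x) (x : X) (m : M) :
    Diag.map M f hf (Twisted.single _ M x m) = Twisted.single _ M (f x) m :=
  Twisted.linearLift_single _ _ _ _

/-- The augmentation. -/
noncomputable def Diag.augmentation (X : Type u) [MulAction G X] :
    Diag G X M →ₗ[MonoidAlgebra ℤ G] M :=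
  Twisted.linearLift (fun _ => AddMonoidHom.id M) fun _ _ _ => rfl

@[simp]
theorem Diag.augmentation_single (x : X) (m : M) :
    Diag.augmentation (G := G) M X (Twisted.single _ M x m) = m :=
  Twisted.linearLift_single _ _ _ _

section Tree

variable {M} {o t : E → V} (ho : ∀ (g : G) e, o (g • e) = g • o e)
  (ht : ∀ (g : G) e, t (g • e) = g • t e)

variable (M) in
/-- The boundary map of a graph with an action of a group. -/
noncomputable def Diag.boundary : Diag G E M →ₗ[MonoidAlgebra ℤ G] Diag G V M :=
  Diag.map M t ht - Diag.map M o ho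

theorem Diag.boundary_single (e : E) (m : M) :
    Diag.boundary M ho ht (Twisted.single _ M e m) =
      Twisted.single _ M (t e) m - Twisted.single _ M (o e) m := by
  simp [Diag.boundary]

/-- The tautological cochain sending `e` to `Twisted.single _ M e`, with values in the additive
group of maps `M → M[E]`, has a potential, and that potential defines a retraction of the boundary.
-/
theorem IsTree.boundary_injective (hT : IsTree o t) :
    Function.Injective (Diag.boundary M ho ht) := by
  obtain ⟨f, hf⟩ := hT.coboundary (Multiplicative (M →+ Diag G E M))
    fun e => Multiplicative.ofAdd (Twisted.single _ M e)
  let r : Diag G V M →+ Diag G E M := Twisted.lift _ fun v => (f v).toAdd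
  have hr : r.comp (Diag.boundary M ho ht).toAddMonoidHom = AddMonoidHom.id _ := by
    refine Twisted.addHom_ext fun e m => ?_
    have h1 : (f (t e)).toAdd = (f (o e)).toAdd + Twisted.single _ M e :=
      congrArg Multiplicative.toAdd (hf e)
    show r (Diag.boundary M ho ht (Twisted.single _ M e m)) = Twisted.single _ M e m
    rw [Diag.boundary_single, map_sub, Twisted.lift_single, Twisted.lift_single, h1]
    simp
  exact Function.LeftInverse.injective (g := r) fun x => DFunLike.congr_fun hr x

/-- Modulo boundaries the class of `m` placed at `v` does not depend on `v`, by connectedness. Every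
element is thus congruent to its augmentation placed at a base vertex. -/
theorem IsTree.boundary_exact (hT : IsTree o t) :
    Function.Exact (Diag.boundary M ho ht) (Diag.augmentation M V) := by
  have h0 : (Diag.augmentation M V).comp (Diag.boundary M ho ht) = 0 :=
    Twisted.linearMap_ext fun e m => by simp [Diag.boundary_single]
  obtain ⟨v₀⟩ := hT.nonempty
  let π := (LinearMap.range (Diag.boundary M ho ht)).mkQ
  have hedge : ∀ e m, π (Twisted.single _ M (t e) m) = π (Twisted.single _ M (o e) m) := by
    intro e m
    refine (Submodule.Quotient.eq _).2 ⟨Twisted.single _ M e m, Diag.boundary_single ho ht e m⟩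
  have hU : {v | ∀ m, π (Twisted.single _ M v m) = π (Twisted.single _ M v₀ m)} = Set.univ :=
    hT.connected _ (fun e => forall_congr' fun m => by rw [hedge]) ⟨v₀, fun _ => rfl⟩
  have hπ : π.toAddMonoidHom = (π.toAddMonoidHom.comp (Twisted.single _ M v₀)).comp
      (Diag.augmentation M V).toAddMonoidHom := by
    refine Twisted.addHom_ext fun v m => ?_
    have hv : v ∈ {v | ∀ m, π (Twisted.single _ M v m) = π (Twisted.single _ M v₀ m)} :=
      hU ▸ Set.mem_univ v
    refine (hv m).trans ?_
    show _ = π (Twisted.single _ M v₀ (Diag.augmentation M V (Twisted.single _ M v m)))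
    rw [Diag.augmentation_single]
  intro x
  refine ⟨fun hx => ?_, ?_⟩
  · have h1 : π x = π (Twisted.single _ M v₀ (Diag.augmentation M V x)) :=
      DFunLike.congr_fun hπ x
    rw [hx, map_zero, map_zero] at h1
    exact (Submodule.Quotient.mk_eq_zero _).1 h1
  · rintro ⟨y, rfl⟩
    exact LinearMap.congr_fun h0 y

theorem IsTree.augmentation_surjective {E : Type u} {o t : E → V} (hT : IsTree o t) :
    Function.Surjective (Diag.augmentation (G := G) M V) := by
  obtain ⟨v₀⟩ := hT.nonempty
  exact fun m => ⟨Twisted.single _ M v₀ m, Diag.augmentation_single M v₀ m⟩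

end Tree

/-- The diagonal module of a transitive `G`-set is induced. -/
noncomputable def indResEquiv {H : Type u} [Group H] (i : H →* G) (hi : Function.Injective i)
    (M : ModuleCat.{u} (MonoidAlgebra ℤ G)) :
    Twisted (cosetCocycle i hi) ((resFunctor i).obj M) ≃ₗ[MonoidAlgebra ℤ G]
      Diag G (G ⧸ i.range) M := by
  let φ : (resFunctor i).obj M →ₛₗ[MonoidAlgebra.mapDomainRingHom ℤ i] M :=
    (ModuleCat.semilinearMapAddEquiv _ _ M).symm (𝟙 _)
  -- Acting by the coset representative `x.out` on the value at `x` converts the cocycle action into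
  -- the diagonal one.
  let f : Twisted (cosetCocycle i hi) ((resFunctor i).obj M) →ₗ[MonoidAlgebra ℤ G]
      Diag G (G ⧸ i.range) M :=
    Twisted.linearLift (fun x => (Twisted.single _ M x).comp
      ((DistribSMul.toAddMonoidHom M (grp x.out)).comp φ.toAddMonoidHom)) fun g x n => by
        show Twisted.single _ M (g • x) (grp (g • x).out • φ (grp _ • n)) =
          grp g • Twisted.single _ M x (grp x.out • φ n)
        rw [semilinearMap_grp_smul, Twisted.grp_smul_single, ← mul_smul, ← mul_smul, ← map_mul,
          ← map_mul, apply_cosetCocycle, mul_inv_cancel_left, diagCocycle_toFun]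
  let h : Diag G (G ⧸ i.range) M →+ Twisted (cosetCocycle i hi) ((resFunctor i).obj M) :=
    Twisted.lift _ fun x => (Twisted.single _ ((resFunctor i).obj M) x).comp
      (DistribSMul.toAddMonoidHom M (grp x.out⁻¹))
  have hf : ∀ x n, f (Twisted.single _ _ x n) = Twisted.single _ M x (grp x.out • φ n) :=
    fun x n => Twisted.linearLift_single _ _ _ _
  have hh : ∀ x m, h (Twisted.single _ M x m) =
      Twisted.single _ ((resFunctor i).obj M) x (grp x.out⁻¹ • m : M) :=
    fun x n => Twisted.lift_single _ _ _
  have h1 : h.comp f.toAddMonoidHom = AddMonoidHom.id _ := Twisted.addHom_ext fun x n => by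
    refine (congrArg h (hf x n)).trans ((hh _ _).trans ?_)
    rw [← mul_smul, ← map_mul, inv_mul_cancel, map_one, one_smul]
    rfl
  have h2 : f.toAddMonoidHom.comp h = AddMonoidHom.id _ := Twisted.addHom_ext fun x n => by
    refine (congrArg f (hh x n)).trans ((hf _ _).trans ?_)
    refine congrArg (Twisted.single _ M x) ?_
    show grp x.out • (grp x.out⁻¹ • n : M) = n
    rw [← mul_smul, ← map_mul, mul_inv_cancel, map_one, one_smul]
  exact
    { f with
      invFun := h
      left_inv := fun x => DFunLike.congr_fun h1 x
      right_inv := fun x => DFunLike.congr_fun h2 x }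

theorem diag_coset_mem
    {C : ObjectProperty (ModuleCat.{u} (MonoidAlgebra ℤ G))}
    (hC : IsExactClass (MonoidAlgebra ℤ G) C) (hC' : IsCocompleteClass (MonoidAlgebra ℤ G) C)
    (hP : ∀ P : ModuleCat.{u} (MonoidAlgebra ℤ G), Module.Finite (MonoidAlgebra ℤ G) P →
      Module.Projective (MonoidAlgebra ℤ G) P → C P)
    {H : Type u} [Group H] (i : H →* G) (hi : Function.Injective i)
    (hH : LeftRegular (MonoidAlgebra ℤ H)) (M : ModuleCat.{u} (MonoidAlgebra ℤ G)) :
    C (ModuleCat.of _ (Diag G (G ⧸ i.range) M)) :=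
  hC.mem_of_linearEquiv hP (indResEquiv i hi M)
    (ind_mem i hi hH hC hC' hP ((resFunctor i).obj M))

/-- Used for the vertices of the tree of an amalgam, which form two orbits; the sequence is split.
-/
theorem diag_sum_mem
    {C : ObjectProperty (ModuleCat.{u} (MonoidAlgebra ℤ G))}
    (hC : IsExactClass (MonoidAlgebra ℤ G) C)
    (hX : C (ModuleCat.of _ (Diag G X M))) (hY : C (ModuleCat.of _ (Diag G Y M))) :
    C (ModuleCat.of _ (Diag G (X ⊕ Y) M)) := by
  let f : Diag G X M →ₗ[MonoidAlgebra ℤ G] Diag G (X ⊕ Y) M := Diag.map M Sum.inl fun _ _ => rfl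
  let s : Diag G Y M →ₗ[MonoidAlgebra ℤ G] Diag G (X ⊕ Y) M := Diag.map M Sum.inr fun _ _ => rfl
  let p : Diag G (X ⊕ Y) M →ₗ[MonoidAlgebra ℤ G] Diag G X M :=
    Twisted.linearLift (Sum.elim (fun x => Twisted.single _ M x) 0) (by
      rintro g (x | y) m <;> simp)
  let q : Diag G (X ⊕ Y) M →ₗ[MonoidAlgebra ℤ G] Diag G Y M :=
    Twisted.linearLift (Sum.elim 0 (fun y => Twisted.single _ M y)) (by
      rintro g (x | y) m <;> simp)
  have hf : ∀ x m, f (Twisted.single _ M x m) = Twisted.single _ M (Sum.inl x) m :=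
    fun x m => Diag.map_single M _ _ x m
  have hs : ∀ y m, s (Twisted.single _ M y m) = Twisted.single _ M (Sum.inr y) m :=
    fun y m => Diag.map_single M _ _ y m
  have hp : ∀ z m, p (Twisted.single _ M z m) =
      Sum.elim (fun x => Twisted.single _ M x) (0 : Y → M →+ Diag G X M) z m :=
    fun z m => Twisted.linearLift_single _ _ z m
  have hq : ∀ z m, q (Twisted.single _ M z m) =
      Sum.elim (0 : X → M →+ Diag G Y M) (fun y => Twisted.single _ M y) z m :=
    fun z m => Twisted.linearLift_single _ _ z m
  have hpf : p.comp f = LinearMap.id := Twisted.linearMap_ext fun x m => by simp [hp, hf]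
  have hqs : q.comp s = LinearMap.id := Twisted.linearMap_ext fun x m => by simp [hq, hs]
  have hqf : q.comp f = 0 := Twisted.linearMap_ext fun x m => by simp [hq, hf]
  have hsum : f.comp p + s.comp q = LinearMap.id := Twisted.linearMap_ext (by
    rintro (x | y) m <;> simp [hp, hq, hf, hs])
  refine hC.middle_mem (X := ModuleCat.of _ (Diag G X M)) (Z := ModuleCat.of _ (Diag G Y M))
    f q ?_ ?_ ?_ hX hY
  · exact Function.LeftInverse.injective (g := p) fun x => LinearMap.congr_fun hpf x
  · intro z
    refine ⟨fun hz => ⟨p z, ?_⟩, ?_⟩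
    · have := LinearMap.congr_fun hsum z
      simpa [show q z = 0 from hz] using this
    · rintro ⟨x, rfl⟩
      exact LinearMap.congr_fun hqf x
  · exact fun y => ⟨s y, LinearMap.congr_fun hqs y⟩

theorem IsTree.mem
    {C : ObjectProperty (ModuleCat.{u} (MonoidAlgebra ℤ G))}
    (hC : IsExactClass (MonoidAlgebra ℤ G) C)
    {o t : E → V} (hT : IsTree o t)
    (ho : ∀ (g : G) e, o (g • e) = g • o e)
    (ht : ∀ (g : G) e, t (g • e) = g • t e) (M : ModuleCat.{u} (MonoidAlgebra ℤ G))
    (hE : C (ModuleCat.of _ (Diag G E M))) (hV : C (ModuleCat.of _ (Diag G V M))) : C M :=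
  hC.right_mem (X := ModuleCat.of _ (Diag G E M)) (Y := ModuleCat.of _ (Diag G V M))
    (Diag.boundary M ho ht) (Diag.augmentation M V) (hT.boundary_injective ho ht)
    (hT.boundary_exact ho ht) hT.augmentation_surjective hE hV

/-- A module over the group ring of a directed union of subgroups is a filtered colimit of modules
induced from the subgroups. -/
theorem directed_union_mem
    {C : ObjectProperty (ModuleCat.{u} (MonoidAlgebra ℤ G))}
    (hC : IsExactClass (MonoidAlgebra ℤ G) C) (hC' : IsCocompleteClass (MonoidAlgebra ℤ G) C)
    (hP : ∀ P : ModuleCat.{u} (MonoidAlgebra ℤ G), Module.Finite (MonoidAlgebra ℤ G) P →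
      Module.Projective (MonoidAlgebra ℤ G) P → C P)
    {ι : Type u} [Nonempty ι] (K : ι → Subgroup G)
    (hdir : Directed (· ≤ ·) K) (htop : ∀ g : G, ∃ i, g ∈ K i)
    (hK : ∀ i, LeftRegular (MonoidAlgebra ℤ (K i))) (M : ModuleCat.{u} (MonoidAlgebra ℤ G)) :
    C M := by
  classical
  -- The index type `ι` carries no order, so the colimit is taken over the subgroups themselves,
  -- ordered by inclusion.
  let J := {A : Subgroup G // ∃ i, K i = A}
  have hJdir : IsDirectedOrder J := ⟨by
    rintro ⟨_, i, rfl⟩ ⟨_, j, rfl⟩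
    obtain ⟨m, h1, h2⟩ := hdir i j
    exact ⟨⟨K m, m, rfl⟩, h1, h2⟩⟩
  have hJ : Nonempty J := ⟨⟨_, Classical.arbitrary ι, rfl⟩⟩
  have hle : ∀ {A B : J}, A ≤ B → ∀ a ∈ A.1, 1⁻¹ * a * 1 ∈ B.1 := fun h a ha => by
    simpa using h ha
  let X : J → Type u := fun A => Diag G (G ⧸ A.1) M
  let f : ∀ A B : J, A ≤ B → X A →ₗ[MonoidAlgebra ℤ G] X B := fun A B h =>
    Diag.map M (cosetMap 1 (hle h)) (cosetMap_smul 1 (hle h))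
  have hf : ∀ (A B : J) (h : A ≤ B) (g : G) (m : M),
      f A B h (Twisted.single _ M (QuotientGroup.mk g) m) =
        Twisted.single _ M (QuotientGroup.mk g) m := fun A B h g m => by
    refine (Diag.map_single M _ _ _ _).trans ?_
    rw [cosetMap_mk, mul_one]
  have hext : ∀ {A : J} {N : Type u} [AddCommGroup N] {a b : X A →+ N}
      (_ : ∀ (g : G) m, a (Twisted.single _ M (QuotientGroup.mk g) m) =
        b (Twisted.single _ M (QuotientGroup.mk g) m)), a = b := by
    intro A N _ a b h
    refine Twisted.addHom_ext fun x m => ?_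
    induction x using QuotientGroup.induction_on with
    | H g => exact h g m
  have hsys : DirectedSystem X fun A B h => f A B h :=
    { map_self := fun A x => by
        have : (f A A le_rfl).toAddMonoidHom = AddMonoidHom.id _ := hext fun g m =>
          hf A A le_rfl g m
        exact DFunLike.congr_fun this x
      map_map := fun D B A hAB hBD x => by
        have : (f B D hBD).toAddMonoidHom.comp (f A B hAB).toAddMonoidHom =
            (f A D (hAB.trans hBD)).toAddMonoidHom := hext fun g m => by
          refine (congrArg (f B D hBD) (hf _ _ hAB g m)).trans ((hf _ _ hBD g m).trans ?_)
          exact (hf _ _ (hAB.trans hBD) g m).symm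
        exact DFunLike.congr_fun this x }
  have hlim := hC'.directLimit_mem X f fun A => by
    obtain ⟨_, i, rfl⟩ := A
    have := diag_coset_mem hC hC' hP (K i).subtype Subtype.val_injective (hK i) M
    rwa [Subgroup.range_subtype] at this
  let l : Module.DirectLimit X f →ₗ[MonoidAlgebra ℤ G] M :=
    Module.DirectLimit.lift _ _ X f (fun A => Diag.augmentation (G := G) M (G ⧸ A.1))
      fun A B h x => by
        have : (Diag.augmentation (G := G) M (G ⧸ B.1)).toAddMonoidHom.comp
            (f A B h).toAddMonoidHom =
            (Diag.augmentation (G := G) M (G ⧸ A.1)).toAddMonoidHom := hext fun g m => by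
          refine (congrArg (Diag.augmentation (G := G) M (G ⧸ B.1)) (hf A B h g m)).trans ?_
          exact (Diag.augmentation_single M _ m).trans (Diag.augmentation_single M _ m).symm
        exact DFunLike.congr_fun this x
  let A₀ : J := Classical.arbitrary J
  let s : M →+ Module.DirectLimit X f :=
    (Module.DirectLimit.of _ _ X f A₀).toAddMonoidHom.comp
      (Twisted.single _ M (QuotientGroup.mk 1))
  have hl : ∀ A g m, l (Module.DirectLimit.of _ _ X f A
      (Twisted.single _ M (QuotientGroup.mk g) m)) = m := fun A g m => by
    refine (Module.DirectLimit.lift_of _ _ _).trans ?_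
    exact Diag.augmentation_single M _ m
  -- Some subgroup of the family contains `g`; in a larger one the cosets of `g` and `1` coincide,
  -- so the colimit forgets the coset and only `m` remains.
  have hind : ∀ A g m, Module.DirectLimit.of _ _ X f A
      (Twisted.single _ M (QuotientGroup.mk g) m) = s m := by
    intro A g m
    obtain ⟨i, hi⟩ := htop g
    obtain ⟨B, hB1, hB2⟩ := exists_ge_ge A (⟨K i, i, rfl⟩ : J)
    obtain ⟨D, hD1, hD2⟩ := exists_ge_ge A₀ B
    have e : (QuotientGroup.mk g : G ⧸ D.1) = QuotientGroup.mk 1 := by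
      have := QuotientGroup.mk_mul_of_mem (s := D.1) 1 (hD2 (hB2 hi))
      rwa [one_mul] at this
    show _ = Module.DirectLimit.of _ _ X f A₀ (Twisted.single _ M (QuotientGroup.mk 1) m)
    rw [← Module.DirectLimit.of_f (hij := hD1), ← Module.DirectLimit.of_f (hij := hB1.trans hD2),
      hf _ _ hD1, hf _ _ (hB1.trans hD2), e]
  refine hC.mem_of_linearEquiv hP (M := ModuleCat.of _ (Module.DirectLimit X f))
    { l with
      invFun := s
      left_inv := fun z => ?_
      right_inv := fun m => hl A₀ 1 m } hlim
  induction z using Module.DirectLimit.induction_on with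
  | ih A x =>
    have : (s.comp l.toAddMonoidHom).comp (Module.DirectLimit.of _ _ X f A).toAddMonoidHom =
        (Module.DirectLimit.of _ _ X f A).toAddMonoidHom := hext fun g m =>
      (congrArg s (hl A g m)).trans (hind A g m).symm
    exact DFunLike.congr_fun this x

end DiagonalModules

/-! ### Regularity of the groups in the class -/

section RegularGroups

theorem leftRegular_of_subsingleton (G : Type u) [Group G] [Subsingleton G] :
    LeftRegular (MonoidAlgebra ℤ G) := by
  -- The group ring of the trivial group is `ℤ`, lifted to the universe of `G`.
  let e : ULift.{u} ℤ ≃+* MonoidAlgebra ℤ G :=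
    ULift.ringEquiv.trans (MonoidAlgebra.uniqueRingEquiv G).symm
  have : IsPrincipalIdealRing (ULift.{u} ℤ) :=
    IsPrincipalIdealRing.of_surjective (ULift.ringEquiv (R := ℤ)).symm.toRingHom
      (ULift.ringEquiv (R := ℤ)).symm.surjective
  have : IsDomain (ULift.{u} ℤ) := (ULift.ringEquiv (R := ℤ)).toMulEquiv.isDomain ℤ
  exact (leftRegular_of_isPrincipalIdealRing (ULift.{u} ℤ)).of_ringEquiv e

/-- The integral group ring of a group is isomorphic to its opposite. -/
noncomputable def groupRingOpEquiv (G : Type u) [Group G] :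
    MonoidAlgebra ℤ G ≃+* (MonoidAlgebra ℤ G)ᵐᵒᵖ :=
  ((MonoidAlgebra.mapDomainRingEquiv ℤ (MulEquiv.inv' G)).trans
    (MonoidAlgebra.mapRingEquiv Gᵐᵒᵖ (RingEquiv.toOpposite ℤ))).trans
    MonoidAlgebra.opRingEquiv.symm

/-- In the tree sequence of an amalgam or HNN extension, the edge term is induced from `H` and the
vertex term is built from modules induced from the factors or the base, all covered by the induction
hypotheses. -/
theorem ClBar.leftRegular {G : Type u} [Group G] (hG : ClBar G) :
    LeftRegular (MonoidAlgebra ℤ G) := by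
  induction hG with
  | trivial G hG => exact leftRegular_of_subsingleton G
  | @amalgam H G₁ G₂ Γ _ _ _ _ α β i₁ i₂ hα hβ hΓ _ _ _ _ ihH ih₁ ih₂ =>
    obtain ⟨hi₁, hi₂⟩ := isPushout_injective hα hβ hΓ
    have h1 : ∀ a ∈ (i₁.comp α).range, (1 : Γ)⁻¹ * a * 1 ∈ i₁.range := by
      rintro _ ⟨a, rfl⟩
      exact ⟨α a, by simp⟩
    have h2 : ∀ a ∈ (i₁.comp α).range, (1 : Γ)⁻¹ * a * 1 ∈ i₂.range := by
      rintro _ ⟨a, rfl⟩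
      exact ⟨β a, by simp [isPushout_apply_eq hΓ]⟩
    intro C hC hC' hP M
    exact (isTree_of_isPushout hΓ h1 h2).mem (hC := hC)
      (fun k e => congrArg Sum.inl (cosetMap_smul 1 h1 k e))
      (fun k e => congrArg Sum.inr (cosetMap_smul 1 h2 k e)) M
      (diag_coset_mem hC hC' hP _ (fun _ _ hab => hα (hi₁ hab)) ihH M)
      (diag_sum_mem M hC (diag_coset_mem hC hC' hP _ hi₁ ih₁ M)
        (diag_coset_mem hC hC' hP _ hi₂ ih₂ M))
  | @hnn H G Γ _ _ _ α β hα hβ e _ _ _ ihH ihG =>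
    refine LeftRegular.of_ringEquiv (MonoidAlgebra.mapDomainRingEquiv ℤ e) ?_
    have h1 : ∀ a ∈ ((HNNExtension.of : G →* HNN α β hα hβ).comp α).range,
        1⁻¹ * a * 1 ∈ (HNNExtension.of : G →* HNN α β hα hβ).range := by
      rintro _ ⟨a, rfl⟩
      exact ⟨α a, by simp⟩
    have h2 := HNN.conj_mem_range hα hβ
    have hi : Function.Injective (HNNExtension.of : G →* HNN α β hα hβ) :=
      HNNExtension.of_injective _
    intro C hC hC' hP M
    exact (isTree_HNN hα hβ h1 h2).mem (hC := hC) (cosetMap_smul 1 h1) (cosetMap_smul _ h2) M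
      (diag_coset_mem hC hC' hP _ (fun _ _ hab => hα (hi hab)) ihH M)
      (diag_coset_mem hC hC' hP _ hi ihG M)
  | @union G _ ι _ K hdir htop hK ih =>
    intro C hC hC' hP M
    exact directed_union_mem hC hC' hP K hdir htop ih M

/-- The groups in the class are regular. -/
theorem ClBar.regularGroup {G : Type u} [Group G] (hG : ClBar G) : RegularGroup G :=
  ⟨hG.leftRegular.of_ringEquiv (groupRingOpEquiv G), hG.leftRegular⟩

end RegularGroups

end VogelRegular

theorem lemma3p9 :
    -- stable under subgroups
    (∀ (G : Type u) [Group G], VogelRegular.ClBar G →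
      ∀ K : Subgroup G, VogelRegular.ClBar K) ∧
    -- stable under extensions `1 → N → Γ → Q → 1`
    (∀ (N Γ Q : Type u) [Group N] [Group Γ] [Group Q] (f : N →* Γ) (g : Γ →* Q),
      Function.Injective f → Function.Surjective g → f.range = g.ker →
      VogelRegular.ClBar N → VogelRegular.ClBar Q → VogelRegular.ClBar Γ) ∧
    -- every group in the class is regular
    (∀ (G : Type u) [Group G], VogelRegular.ClBar G → VogelRegular.RegularGroup G) ∧
    -- the class contains Waldhausen's class
    (∀ (G : Type u) [Group G], VogelRegular.WaldhausenCl G → VogelRegular.ClBar G) := by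
  exact ⟨fun G _ hG K => hG.subgroup K,
    fun N Γ Q _ _ _ f g hf _ h hN hQ => VogelRegular.ClBar.extension f g hf h hN hQ,
    fun G _ hG => hG.regularGroup,
    fun G _ hG => hG.mono fun _ _ _ => trivial⟩
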